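/- Let $f=f(t,x)$ be a smooth function on an open subset of the $(t,x)$-plane with $f_{xxx}=0$ that is nonconstant (on every nonempty open part of its domain), and consider the generalized Burgers equation $\mathcal L_f$: $u_t+uu_x+fu_{xx}=0$; the class of all these equations is denoted by $\mathcal L^2$. For a smooth nowhere vanishing function $\lambda=\lambda(t)$ with $\lambda_t=f_{xx}\lambda$, let $\mathcal R_{f,\lambda}$ be the associated potential system $$v_x=\lambda u,\qquad v_t=-\lambda\left(\tfrac12u^2+fu_x-f_xu\right).$$ A (local) point transformation is a smooth map of an open set of a coordinate space into this space with nowhere vanishing Jacobian determinant. A usual admissible transformation of $\mathcal L^2$ is a triple $(f,\psi,\tilde f)$, where $\psi$ is a point transformation of the space of $(t,x,u)$ that maps $\mathcal L_f$ to $\mathcal L_{\tilde f}$, both equations belonging to $\mathcal L^2$. A potential admissible transformation of $\mathcal L^2$ is a triple $((f,\lambda),\varphi,(\tilde f,\tilde\lambda))$, where $\varphi$ is a point transformation of the space of $(t,x,u,v)$ that maps $\mathcal R_{f,\lambda}$ to $\mathcal R_{\tilde f,\tilde\lambda}$, with $\mathcal L_f,\mathcal L_{\tilde f}\in\mathcal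 L^2$. (That a transformation maps one equation or system to another means that its prolongation maps the set of jets satisfying the first onto the set of jets satisfying the second, wherever the prolongation is defined.) Then: 1. Every potential admissible transformation $((f,\lambda),\varphi,(\tilde f,\tilde\lambda))$ of $\mathcal L^2$ is induced by a usual one: locally, near each point of the domain of $\varphi$, the $(t,x,u)$-components of $\varphi$ do not depend on $v$ and constitute a point transformation $\psi$ such that $(f,\psi,\tilde f)$ is a usual admissible transformation of $\mathcal L^2$. 2. In particular, equations from $\mathcal L^2$ have no nontrivial potential symmetries: if a vector field on an open set of the space of $(t,x,u,v)$ generates a local one-parameter group of point symmetries of $\mathcal R_{f,\lambda}$, then locally its $(t,x,u)$-components do not depend on $v$ and constitute a vector field that generates a local one-parameter group of point symmetries of $\mathcal L_f$. -/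

import Mathlib

open scoped ContDiff

noncomputable section

namespace GenBurgers

/-! ## Point transformations and one-parameter groups of them -/

/-- A (local) point transformation of `E = ℝⁿ` defined on the open set `Ω`: a smooth map whose
Jacobian determinant vanishes nowhere on `Ω`. -/
structure IsPointTransformation {E : Type*} [NormedAddCommGroup E] [NormedSpace ℝ E]
    (Ω : Set E) (φ : E → E) : Prop where
  isOpen : IsOpen Ω
  smooth : ContDiffOn ℝ ∞ φ Ω
  jacobian_ne_zero : ∀ p ∈ Ω, (fderiv ℝ φ p).det ≠ 0

/-- The smooth vector field `Q` on the open set `Ω` generates a local one-parameter group of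
transformations with the property `IsSym` (`IsSym N ψ`: the transformation `ψ` with domain `N` is a
symmetry): around every point of `Ω` there is a local flow `Φ` of `Q`, each of whose maps `Φ s` is
a symmetry. -/
structure IsLieSymmetryField {E : Type*} [NormedAddCommGroup E] [NormedSpace ℝ E]
    (IsSym : Set E → (E → E) → Prop) (Ω : Set E) (Q : E → E) : Prop where
  isOpen : IsOpen Ω
  smooth : ContDiffOn ℝ ∞ Q Ω
  flow : ∀ p ∈ Ω, ∃ N : Set E, IsOpen N ∧ p ∈ N ∧ N ⊆ Ω ∧
    ∃ ε : ℝ, 0 < ε ∧ ∃ Φ : ℝ → E → E,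
      ContDiffOn ℝ ∞ (fun y : ℝ × E => Φ y.1 y.2) (Set.Ioo (-ε) ε ×ˢ N) ∧
      (∀ q ∈ N, Φ 0 q = q) ∧
      (∀ s ∈ Set.Ioo (-ε) ε, ∀ q ∈ N,
        Φ s q ∈ Ω ∧ HasDerivAt (fun r => Φ r q) (Q (Φ s q)) s) ∧
      (∀ s ∈ Set.Ioo (-ε) ε, IsSym N (Φ s))

/-! ## Generalized Burgers equations `u_t + u u_x + f(t,x) u_xx = 0` -/

/-- The arbitrary element `f = f(t,x)` of the class of generalized Burgers equations: a smooth
function on an open set `dom` of the `(t,x)`-plane. The inequality `f ≠ 0` is understood locally: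
`f` does not vanish identically on any nonempty open part of its domain. -/
structure Coeff where
  dom : Set (ℝ × ℝ)
  f : ℝ × ℝ → ℝ
  isOpen_dom : IsOpen dom
  smooth : ContDiffOn ℝ ∞ f dom
  ne_zero : ∀ W ⊆ dom, IsOpen W → W.Nonempty → ∃ p ∈ W, f p ≠ 0

/-- `f_x` at `(t,x)`. -/
def Coeff.fx (F : Coeff) (t x : ℝ) : ℝ := deriv (fun y => F.f (t, y)) x

/-- `f_xx` at `(t,x)`. -/
def Coeff.fxx (F : Coeff) (t x : ℝ) : ℝ := iteratedDeriv 2 (fun y => F.f (t, y)) x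

/-- The class `𝓛²`: `f_xxx = 0` and `f ≠ const`, where the inequality is again understood locally:
`f` is not constant on any nonempty open part of its domain. -/
structure Coeff.MemL2 (F : Coeff) : Prop where
  fxxx_eq_zero : ∀ t x : ℝ, (t, x) ∈ F.dom → iteratedDeriv 3 (fun y => F.f (t, y)) x = 0
  nonconst : ∀ W ⊆ F.dom, IsOpen W → W.Nonempty → ¬ ∃ c : ℝ, ∀ p ∈ W, F.f p = c

/-- The space of `(t,x,u)`. -/
abbrev E3 : Type := ℝ × ℝ × ℝ

/-- First-order jets `((t,x,u),(u_t,u_x))`. -/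
abbrev Jet1 : Type := E3 × ℝ × ℝ

/-- Second-order jets `(((t,x,u),(u_t,u_x)),(u_tt,u_tx,u_xx))`. -/
abbrev Jet2 : Type := Jet1 × ℝ × ℝ × ℝ

/-- Total derivative `D_t` of a function of `(t,x,u)`. -/
def Dt (G : E3 → ℝ) (z : Jet1) : ℝ := fderiv ℝ G z.1 (1, 0, z.2.1)

/-- Total derivative `D_x` of a function of `(t,x,u)`. -/
def Dx (G : E3 → ℝ) (z : Jet1) : ℝ := fderiv ℝ G z.1 (0, 1, z.2.2)

/-- Total derivative `D_t` of a function of `(t,x,u,u_t,u_x)`. -/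
def Dt₁ (H : Jet1 → ℝ) (w : Jet2) : ℝ :=
  fderiv ℝ H w.1 ((1, 0, w.1.2.1), (w.2.1, w.2.2.1))

/-- Total derivative `D_x` of a function of `(t,x,u,u_t,u_x)`. -/
def Dx₁ (H : Jet1 → ℝ) (w : Jet2) : ℝ :=
  fderiv ℝ H w.1 ((0, 1, w.1.2.2), (w.2.2.1, w.2.2.2))

section Prolongation

variable (φ : E3 → E3)

/-- The component `T` of a transformation of the space of `(t,x,u)`. -/
def compT (p : E3) : ℝ := (φ p).1

/-- The component `X` of a transformation of the space of `(t,x,u)`. -/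
def compX (p : E3) : ℝ := (φ p).2.1

/-- The component `U` of a transformation of the space of `(t,x,u)`. -/
def compU (p : E3) : ℝ := (φ p).2.2

/-- The total Jacobian `D_t T · D_x X - D_x T · D_t X`. -/
def totalJac (z : Jet1) : ℝ :=
  Dt (compT φ) z * Dx (compX φ) z - Dx (compT φ) z * Dt (compX φ) z

/-- The transformed derivative `ũ_t̃`, by the chain rule. -/
def newUt (z : Jet1) : ℝ :=
  (Dt (compU φ) z * Dx (compX φ) z - Dx (compU φ) z * Dt (compX φ) z) / totalJac φ z

/-- The transformed derivative `ũ_x̃`, by the chain rule. -/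
def newUx (z : Jet1) : ℝ :=
  (Dt (compT φ) z * Dx (compU φ) z - Dx (compT φ) z * Dt (compU φ) z) / totalJac φ z

/-- The operator `∂/∂t̃` applied to a function of first-order jets. -/
def newDt (H : Jet1 → ℝ) (w : Jet2) : ℝ :=
  (Dt₁ H w * Dx (compX φ) w.1 - Dx₁ H w * Dt (compX φ) w.1) / totalJac φ w.1

/-- The operator `∂/∂x̃` applied to a function of first-order jets. -/
def newDx (H : Jet1 → ℝ) (w : Jet2) : ℝ :=
  (Dt (compT φ) w.1 * Dx₁ H w - Dx (compT φ) w.1 * Dt₁ H w) / totalJac φ w.1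

/-- The second prolongation of a transformation of the space of `(t,x,u)`
(meaningful on the jets at which the total Jacobian does not vanish). -/
def prolong (w : Jet2) : Jet2 :=
  ((φ w.1.1, (newUt φ w.1, newUx φ w.1)),
    (newDt φ (newUt φ) w, newDx φ (newUt φ) w, newDx φ (newUx φ) w))

end Prolongation

/-- The generalized Burgers equation `u_t + u u_x + f u_xx = 0` as a condition on second-order
jets. -/
def Coeff.BurgersEq (F : Coeff) (w : Jet2) : Prop :=
  w.1.2.1 + w.1.1.2.2 * w.1.2.2 + F.f (w.1.1.1, w.1.1.2.1) * w.2.2.2 = 0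

/-- `(f, φ, f')` is an admissible transformation of the class of generalized Burgers equations:
`φ` is a point transformation of the space of `(t,x,u)`, with domain `Ω`, that maps the equation
with coefficient `f` to the equation with coefficient `f'`. -/
structure IsAdmissible (F F' : Coeff) (Ω : Set E3) (φ : E3 → E3) : Prop where
  point : IsPointTransformation Ω φ
  source : ∀ p ∈ Ω, (p.1, p.2.1) ∈ F.dom
  target : ∀ p ∈ Ω, ((φ p).1, (φ p).2.1) ∈ F'.dom
  maps : ∀ w : Jet2, w.1.1 ∈ Ω → totalJac φ w.1 ≠ 0 →
    (F.BurgersEq w ↔ F'.BurgersEq (prolong φ w))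

/-! ## Potential systems `v_x = λ u`, `v_t = -λ (u²/2 + f u_x - f_x u)` -/

/-- `λ = λ(t)` is a nonzero characteristic of conservation laws: `λ_t = f_xx λ`, `λ ≠ 0`. -/
structure Coeff.IsCharacteristic (F : Coeff) (lam : ℝ → ℝ) : Prop where
  smooth : ContDiffOn ℝ ∞ lam (Prod.fst '' F.dom)
  ode : ∀ t x : ℝ, (t, x) ∈ F.dom → HasDerivAt lam (F.fxx t x * lam t) t
  ne_zero : ∀ t ∈ Prod.fst '' F.dom, lam t ≠ 0

/-- The space of `(t,x,u,v)`. -/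
abbrev E4 : Type := ℝ × ℝ × ℝ × ℝ

/-- The projection of the space of `(t,x,u,v)` to the space of `(t,x,u)`. -/
def proj (q : E4) : E3 := (q.1, q.2.1, q.2.2.1)

/-- First-order jets of pairs `(u,v)` of functions of `(t,x)`, with `pt = (t,x,u,v)`. -/
structure PotJet where
  pt : E4
  ut : ℝ
  ux : ℝ
  vt : ℝ
  vx : ℝ

/-- Total derivative `D_t` of a function of `(t,x,u,v)`. -/
def PotJet.Dt (z : PotJet) (G : E4 → ℝ) : ℝ := fderiv ℝ G z.pt (1, 0, z.ut, z.vt)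

/-- Total derivative `D_x` of a function of `(t,x,u,v)`. -/
def PotJet.Dx (z : PotJet) (G : E4 → ℝ) : ℝ := fderiv ℝ G z.pt (0, 1, z.ux, z.vx)

section PotProlongation

variable (φ : E4 → E4)

/-- The component `T` of a transformation of the space of `(t,x,u,v)`. -/
def potT (q : E4) : ℝ := (φ q).1

/-- The component `X` of a transformation of the space of `(t,x,u,v)`. -/
def potX (q : E4) : ℝ := (φ q).2.1

/-- The component `U` of a transformation of the space of `(t,x,u,v)`. -/
def potU (q : E4) : ℝ := (φ q).2.2.1

/-- The component `V` of a transformation of the space of `(t,x,u,v)`. -/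
def potV (q : E4) : ℝ := (φ q).2.2.2

/-- The total Jacobian `D_t T · D_x X - D_x T · D_t X`. -/
def potTotalJac (z : PotJet) : ℝ :=
  z.Dt (potT φ) * z.Dx (potX φ) - z.Dx (potT φ) * z.Dt (potX φ)

/-- The operator `∂/∂t̃` applied to a function of `(t,x,u,v)`. -/
def potNewDt (G : E4 → ℝ) (z : PotJet) : ℝ :=
  (z.Dt G * z.Dx (potX φ) - z.Dx G * z.Dt (potX φ)) / potTotalJac φ z

/-- The operator `∂/∂x̃` applied to a function of `(t,x,u,v)`. -/
def potNewDx (G : E4 → ℝ) (z : PotJet) : ℝ :=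
  (z.Dt (potT φ) * z.Dx G - z.Dx (potT φ) * z.Dt G) / potTotalJac φ z

/-- The first prolongation of a transformation of the space of `(t,x,u,v)`
(meaningful on the jets at which the total Jacobian does not vanish). -/
def potProlong (z : PotJet) : PotJet where
  pt := φ z.pt
  ut := potNewDt φ (potU φ) z
  ux := potNewDx φ (potU φ) z
  vt := potNewDt φ (potV φ) z
  vx := potNewDx φ (potV φ) z

end PotProlongation

/-- The potential system `v_x = λ u`, `v_t = -λ (u²/2 + f u_x - f_x u)` as a condition on
first-order jets. -/
def Coeff.PotentialSystem (F : Coeff) (lam : ℝ → ℝ) (z : PotJet) : Prop :=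
  z.vx = lam z.pt.1 * z.pt.2.2.1 ∧
  z.vt = -lam z.pt.1 * (z.pt.2.2.1 ^ 2 / 2 + F.f (z.pt.1, z.pt.2.1) * z.ux
    - F.fx z.pt.1 z.pt.2.1 * z.pt.2.2.1)

/-- `((f, λ), φ, (f', λ'))` is a potential admissible transformation: `φ` is a point transformation
of the space of `(t,x,u,v)`, with domain `Ω`, that maps the potential system of `(f, λ)` to the
potential system of `(f', λ')`. -/
structure IsPotentialAdmissible (F : Coeff) (lam : ℝ → ℝ) (F' : Coeff) (lam' : ℝ → ℝ)
    (Ω : Set E4) (φ : E4 → E4) : Prop where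
  point : IsPointTransformation Ω φ
  source : ∀ q ∈ Ω, (q.1, q.2.1) ∈ F.dom
  target : ∀ q ∈ Ω, ((φ q).1, (φ q).2.1) ∈ F'.dom
  maps : ∀ z : PotJet, z.pt ∈ Ω → potTotalJac φ z ≠ 0 →
    (F.PotentialSystem lam z ↔ F'.PotentialSystem lam' (potProlong φ z))

end GenBurgers

end

/-!
Write `λ`, `λ'` for the two characteristics. Through each point `(t,x,u,v)` the potential system of
`(f, λ)` prescribes a two-parameter family of planes, the tangent planes of its solutions, with
parameters `u_t` and `u_x`; a potential admissible transformation `φ = (T,X,U,V)` maps these planes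
to those of the target system.

The target equation `v_x = λ' u` says that `dT ∧ (dV - λ'(T) U dX)` vanishes on the solution planes
unless `dT ∧ dX` does. Where `f ≠ 0`, a decomposable two-form with this property is annihilated by
`∂_u` and `∂_x + λ u ∂_v` (`eq_zero_of_wedge`), and the bracket of these two fields is `λ ∂_v`.
Either way `T = T(t)` (`IsPotentialAdmissible.T_eq`). Comparing coefficients of `u_x` in the target
equation for `v_t` gives `X_u = V_u = 0` and the determining equations
(`IsPotentialAdmissible.determining`). From there on the proof is differential algebra:
`f (X_x + λ u X_v)² = T_t f'(T,X)` forces `X_v = 0`, and the coefficients of `u², u, 1` give, with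
`k = T_t / (λ'(T) X_x²)` and `b = (X_t + 3 f X_xx) / X_x`,

  `2 λ f V_vv = V_v (1 - k λ V_v)`, `2 f V_xv = V_v (b - k V_x)`,
  `2 (V_t + f V_xx) = 2 V_x (b + f_x) - k V_x²`

(`Partials.Determining.reduced`). Solutions with `V_vv ≠ 0` are of Hopf–Cole type. Cross
differentiation in `x` gives `2 f_x V_vv = -k_x V_v²`, whence `f_x V_vv = 0`; where `f_x = 0`, cross
differentiation in `t` gives likewise `f_t V_vv = 0`. As `f` is nowhere locally constant,
`V_vv = 0` (`IsPotentialAdmissible.V_vv`). Then also `V_xv = 0`, so `U` does not depend on `v`;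
moreover `T_t U = X_t + u X_x`, `X_xx = 0`, and `T`, `X` satisfy the two equations
(`Partials.Classified`) which say that `(T,X,U)` multiplies the residual `u_t + u u_x + f u_xx` by
`X_x / T_t²`. So `(T,X,U)` is an admissible transformation
(`IsPotentialAdmissible.isAdmissible_slice`). A potential symmetry field is handled by applying
this to the maps of its flow.

The differential algebra is carried out in the algebra `Sm O` of smooth functions on an open set
`O`, with its four partial derivatives as commuting derivations. The coefficient `f` may have
zeros, but it is not a zero divisor in `Sm O`, so that it can be cancelled.
-/

open scoped ContDiff

open TopologicalSpace

noncomputable section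

namespace GenBurgers

/-! ### Differential algebra of the determining equations -/

section Algebra

variable {A : Type*} [CommRing A] [Algebra ℝ A]

theorem derivation_two (D : Derivation ℝ A A) : D 2 = 0 := by
  exact_mod_cast D.map_natCast 2

theorem derivation_three (D : Derivation ℝ A A) : D 3 = 0 := by
  exact_mod_cast D.map_natCast 3

theorem eq_zero_of_two_mul {a : A} (h : 2 * a = 0) : a = 0 := by
  have h2 : algebraMap ℝ A (1 / 2) * 2 = 1 := by
    rw [← map_ofNat (algebraMap ℝ A) 2, ← map_mul]; norm_num
  linear_combination algebraMap ℝ A (1 / 2) * h - a * h2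

theorem eq_of_two_mul {a b : A} (h : 2 * a = 2 * b) : a = b :=
  sub_eq_zero.1 (eq_zero_of_two_mul (by linear_combination h))

/-- Four commuting derivations of a commutative `ℝ`-algebra, standing for the partial derivatives
with respect to `t, x, u, v`. -/
structure Partials (A : Type*) [CommRing A] [Algebra ℝ A] where
  t : Derivation ℝ A A
  x : Derivation ℝ A A
  u : Derivation ℝ A A
  v : Derivation ℝ A A
  xt : ∀ a, x (t a) = t (x a)
  ut : ∀ a, u (t a) = t (u a)
  vt : ∀ a, v (t a) = t (v a)
  ux : ∀ a, u (x a) = x (u a)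
  vx : ∀ a, v (x a) = x (v a)
  vu : ∀ a, v (u a) = u (v a)

/-- The coefficients of the source potential system, as elements of a differential algebra:
`f` depends on `(t,x)` only, `l = λ` on `t` only, `λ_t = f_xx λ`, and `y` is the coordinate `u`. -/
structure Partials.Source (D : Partials A) (f l y : A) : Prop where
  fu : D.u f = 0
  fv : D.v f = 0
  lt : D.t l = D.x (D.x f) * l
  lx : D.x l = 0
  lu : D.u l = 0
  lv : D.v l = 0
  yt : D.t y = 0
  yx : D.x y = 0
  yu : D.u y = 1
  yv : D.v y = 0
  regular : ∀ a, f * a = 0 → a = 0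
  unit_l : IsUnit l

/-- The target coefficients `g = f'(T,X)`, `g1 = f'_x(T,X)`, `g2 = f'_xx(T,X)`, `m = λ'(T)` along a
transformation whose component `T` depends on `t` only. -/
structure Partials.Target (D : Partials A) (g g1 g2 m T X : A) : Prop where
  Tx : D.x T = 0
  Tu : D.u T = 0
  Tv : D.v T = 0
  gx : D.x g = g1 * D.x X
  gu : D.u g = g1 * D.u X
  g1x : D.x g1 = g2 * D.x X
  mt : D.t m = g2 * m * D.t T
  mx : D.x m = 0
  mu : D.u m = 0
  mv : D.v m = 0
  unit_m : IsUnit m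
  unit_T : IsUnit (D.t T)

/-- The determining equations of a transformation with `T = T(t)`: `space` comes from the equation
for `v_x`, and `top` and `bottom` are the coefficients of `u_x` and `1` in the equation
for `v_t`. -/
structure Partials.Determining (D : Partials A) (f l y g g1 m T X U V : A) : Prop where
  Xu : D.u X = 0
  Vu : D.u V = 0
  space : D.x V + l * y * D.v V = m * U * (D.x X + l * y * D.v X)
  top : l * f * (D.v V - m * U * D.v X) * (D.x X + l * y * D.v X) = m * D.t T * g * D.u U
  bottom : (D.x X + l * y * D.v X) *
      (2 * (D.t V - m * U * D.t X) -
        l * (y ^ 2 - 2 * D.x f * y) * (D.v V - m * U * D.v X)) =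
      -(m * D.t T) * ((U ^ 2 - 2 * g1 * U) * (D.x X + l * y * D.v X) +
        2 * g * (D.x U + l * y * D.v U))
  unit_X : IsUnit (D.x X + l * y * D.v X)
  unit_V : IsUnit (D.v V - m * U * D.v X)

variable {D : Partials A} {f l y g g1 g2 m T X U V : A}

theorem mul_derivation_eq_zero [IsReduced A] (d : Derivation ℝ A A) {p a : A} (h : p * a = 0) :
    p * d a = 0 := by
  have h1 := congrArg d h
  simp only [Derivation.leibniz, smul_eq_mul, map_zero] at h1
  refine IsReduced.eq_zero _ ⟨2, ?_⟩
  linear_combination p * d a * h1 - d a * d p * h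

/-- The vector fields `∂_u` and `∂_x + λ u ∂_v` and their commutator span all directions along
which `t` is constant. -/
theorem Partials.Source.mul_eq_zero_of_bracket [IsReduced A] (S : D.Source f l y) {p a : A}
    (hu : p * D.u a = 0) (hx : p * (D.x a + l * y * D.v a) = 0) :
    p * D.x a = 0 ∧ p * D.v a = 0 := by
  have hux := mul_derivation_eq_zero D.u hx
  have hxu := mul_derivation_eq_zero D.x hu
  have hvu := mul_derivation_eq_zero D.v hu
  simp only [map_add, Derivation.leibniz, smul_eq_mul, D.ux, ← D.vu, S.lu, S.yu] at hux hxu hvu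
  have hv : p * D.v a = 0 := by
    refine S.unit_l.mul_left_cancel ?_
    linear_combination hux - hxu - l * y * hvu
  exact ⟨by linear_combination hx - l * y * hv, hv⟩

/-- The quantity `f (X_x + λ u X_v)² = T_t f'(T,X)` does not depend on `u`, whence `X_v = 0`. -/
theorem Partials.Determining.Xv (S : D.Source f l y) (R : D.Target g g1 g2 m T X)
    (E : D.Determining f l y g g1 m T X U V) : D.v X = 0 := by
  have h1 := congrArg D.u E.space
  simp only [map_add, Derivation.leibniz, smul_eq_mul, D.ux, ← D.vu, E.Vu, E.Xu, S.lu, S.yu, R.mu,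
    map_zero] at h1
  have h2 : f * (D.x X + l * y * D.v X) ^ 2 = D.t T * g := by
    refine (S.unit_l.mul E.unit_V).mul_left_cancel ?_
    linear_combination (D.x X + l * y * D.v X) * E.top - D.t T * g * h1
  have h3 := congrArg D.u h2
  simp only [map_add, Derivation.leibniz, Derivation.leibniz_pow, smul_eq_mul, D.ux, D.ut, ← D.vu,
    E.Xu, S.lu, S.yu, S.fu, R.Tu, R.gu, map_zero, nsmul_eq_mul] at h3
  apply S.regular
  refine (S.unit_l.mul E.unit_X).mul_left_cancel ?_
  refine eq_of_two_mul ?_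
  push_cast at h3
  linear_combination h3

/-- A quadratic polynomial in `u` that vanishes identically has vanishing coefficients. -/
theorem Partials.Source.coeff_eq_zero (S : D.Source f l y) {a b c : A}
    (ha : D.u a = 0) (hb : D.u b = 0) (hc : D.u c = 0) (h : a * y ^ 2 + b * y + c = 0) :
    a = 0 ∧ b = 0 ∧ c = 0 := by
  have h1 := congrArg D.u h
  simp only [map_add, Derivation.leibniz, Derivation.leibniz_pow, smul_eq_mul, S.yu, ha, hb, hc,
    map_zero, nsmul_eq_mul] at h1
  have h2 := congrArg D.u h1
  simp only [map_add, Derivation.leibniz, Derivation.leibniz_pow, smul_eq_mul, S.yu, ha, hb,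
    map_zero, nsmul_eq_mul, Derivation.map_one_eq_zero, Nat.cast_ofNat, derivation_two] at h2
  have ha' : a = 0 := eq_zero_of_two_mul (by push_cast at h2; linear_combination h2)
  subst ha'
  have hb' : b = 0 := by linear_combination h1
  subst hb'
  exact ⟨rfl, rfl, by linear_combination h⟩

/-- The determining equations for `V` once `X = X(t,x)`: `k` and `b` stand for
`T_t / (λ'(T) X_x²)` and `(X_t + 3 f X_xx) / X_x`. -/
structure Partials.Reduced (D : Partials A) (f l y g g1 g2 m T X U V k b : A) : Prop where
  Xu : D.u X = 0
  Xv : D.v X = 0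
  kv : D.v k = 0
  bv : D.v b = 0
  coeff : f * D.x X ^ 2 = D.t T * g
  kdef : m * k * D.x X ^ 2 = D.t T
  bdef : b * D.x X = D.t X + 3 * f * D.x (D.x X)
  Udef : m * U * D.x X = D.x V + l * y * D.v V
  vv : 2 * l * f * D.v (D.v V) = D.v V * (1 - k * l * D.v V)
  xv : 2 * f * D.x (D.v V) = D.v V * (b - k * D.x V)
  tt : 2 * (D.t V + f * D.x (D.x V)) = 2 * D.x V * (b + D.x f) - k * D.x V ^ 2
  unit_X : IsUnit (D.x X)
  unit_V : IsUnit (D.v V)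

/-- Splitting the third determining equation with respect to `u`. -/
theorem Partials.Determining.reduced (S : D.Source f l y) (R : D.Target g g1 g2 m T X)
    (E : D.Determining f l y g g1 m T X U V) :
    ∃ k b, D.Reduced f l y g g1 g2 m T X U V k b := by
  have Xv := E.Xv S R
  have h1 := congrArg D.u E.space
  simp only [map_add, Derivation.leibniz, smul_eq_mul, D.ux, ← D.vu, E.Vu, E.Xu, S.lu, S.yu, R.mu,
    map_zero, Xv] at h1
  obtain ⟨uX, uV, sp, top, bot⟩ := And.intro E.unit_X <| And.intro E.unit_V <|
    And.intro E.space <| And.intro E.top E.bottom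
  simp only [Xv, mul_zero, add_zero, sub_zero] at uX uV sp top bot
  have co : f * D.x X ^ 2 = D.t T * g := by
    refine (S.unit_l.mul uV).mul_left_cancel ?_
    linear_combination D.x X * top - D.t T * g * h1
  have hTx : D.x (D.t T) = 0 := by rw [D.xt, R.Tx, map_zero]
  have co1 : D.x f * D.x X + 2 * f * D.x (D.x X) = D.t T * g1 := by
    have h3 := congrArg D.x co
    simp only [Derivation.leibniz, Derivation.leibniz_pow, smul_eq_mul, R.gx, hTx,
      nsmul_eq_mul] at h3
    refine uX.mul_left_cancel ?_
    push_cast at h3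
    linear_combination h3
  -- `r = 1 / X_x` and `n = 1 / λ'(T)`
  obtain ⟨r, hr⟩ := uX.exists_right_inv
  obtain ⟨n, hn⟩ := R.unit_m.exists_right_inv
  have hru : D.u r = 0 := by
    have := congrArg D.u hr
    simp only [Derivation.leibniz, smul_eq_mul, D.ux, E.Xu, map_zero,
      Derivation.map_one_eq_zero] at this
    linear_combination r * this - D.u r * hr
  have hrv : D.v r = 0 := by
    have := congrArg D.v hr
    simp only [Derivation.leibniz, smul_eq_mul, D.vx, Xv, map_zero,
      Derivation.map_one_eq_zero] at this
    linear_combination r * this - D.v r * hr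
  have hrx : D.x r = - r ^ 2 * D.x (D.x X) := by
    have := congrArg D.x hr
    simp only [Derivation.leibniz, smul_eq_mul, Derivation.map_one_eq_zero] at this
    linear_combination r * this - D.x r * hr
  have hnv : D.v n = 0 := by
    have := congrArg D.v hn
    simp only [Derivation.leibniz, smul_eq_mul, R.mv, Derivation.map_one_eq_zero] at this
    linear_combination n * this - D.v n * hn
  have hmU : m * U = (D.x V + l * y * D.v V) * r := by
    linear_combination -r * sp - m * U * hr
  have hmUx := congrArg D.x hmU
  have hmUv := congrArg D.v hmU
  simp only [map_add, Derivation.leibniz, smul_eq_mul, R.mx, R.mv, hrx, hrv, S.lx, S.yx, S.lv, S.yv,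
    mul_zero, add_zero, zero_add, D.vx] at hmUx hmUv
  -- `E.bottom`, multiplied by `λ'(T) / X_x`, is a quadratic polynomial in `u`.
  have key := S.coeff_eq_zero
    (a := -(m * l * D.v V) + D.t T * r ^ 2 * l ^ 2 * (D.v V) ^ 2 + 2 * f * m * l ^ 2 * D.v (D.v V))
    (b := 2 * m * l * D.v V * D.x f - 2 * m * l * r * D.v V * D.t X
      + 2 * D.t T * r ^ 2 * l * D.x V * D.v V
      - 2 * m * l * D.v V * (D.x f + 2 * f * r * D.x (D.x X))
      + 2 * m * l * f * (D.x (D.v V) - r * D.v V * D.x (D.x X)) + 2 * m * l * f * D.x (D.v V))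
    (c := 2 * m * D.t V - 2 * m * r * D.t X * D.x V + D.t T * r ^ 2 * D.x V ^ 2
      - 2 * m * D.x V * (D.x f + 2 * f * r * D.x (D.x X))
      + 2 * m * f * (D.x (D.x V) - r * D.x V * D.x (D.x X)))
    ?_ ?_ ?_ ?_
  · obtain ⟨k2, k1, k0⟩ := key
    refine ⟨D.t T * n * r ^ 2, (D.t X + 3 * f * D.x (D.x X)) * r, E.Xu, Xv, ?_, ?_, co,
      ?_, ?_, ?_, ?_, ?_, ?_, uX, uV⟩
    · simp only [Derivation.leibniz, Derivation.leibniz_pow, smul_eq_mul, hrv, hnv, D.vt, R.Tv,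
        map_zero]
      simp
    · simp only [map_add, Derivation.leibniz, smul_eq_mul, hrv, D.vt,
        D.vx, Xv, S.fv, derivation_three, map_zero]
      simp
    · linear_combination D.t T * n * m * (D.x X * r + 1) * hr + D.t T * hn
    · linear_combination (D.t X + 3 * f * D.x (D.x X)) * hr
    · linear_combination -sp
    · refine (R.unit_m.mul S.unit_l).mul_left_cancel ?_
      linear_combination k2 + D.t T * r ^ 2 * l ^ 2 * (D.v V) ^ 2 * hn
    · refine (R.unit_m.mul S.unit_l).mul_left_cancel ?_
      refine eq_of_two_mul ?_
      linear_combination k1 + 2 * D.t T * r ^ 2 * l * D.x V * D.v V * hn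
    · refine R.unit_m.mul_left_cancel ?_
      linear_combination k0 + D.t T * r ^ 2 * D.x V ^ 2 * hn
  · simp only [map_add, map_neg, Derivation.leibniz, Derivation.leibniz_pow, smul_eq_mul, hru, D.ut,
      ← D.vu, R.Tu, S.lu, S.fu, R.mu, E.Vu, derivation_two, map_zero]
    simp
  · simp only [map_add, map_sub, Derivation.leibniz, Derivation.leibniz_pow, smul_eq_mul,
      hru, D.ut, D.ux, E.Xu, ← D.vu, R.Tu, S.lu, S.fu, R.mu, E.Vu, derivation_two, map_zero]
    simp
  · simp only [map_add, map_sub, Derivation.leibniz, Derivation.leibniz_pow, smul_eq_mul,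
      hru, D.ut, D.ux, E.Xu, R.Tu, S.fu, R.mu, E.Vu, derivation_two, map_zero]
    simp
  · set S := D.x V + l * y * D.v V with hS
    set S' := D.x (D.x V) + l * y * D.x (D.v V) with hS'
    set S'' := D.x (D.v V) + l * y * D.v (D.v V) with hS''
    linear_combination m * r * bot
      - m * (2 * D.t V - 2 * (m * U) * D.t X - l * (y ^ 2 - 2 * D.x f * y) * D.v V) * hr
      + 2 * m * D.t X * hmU - m ^ 2 * D.t T * (U ^ 2 - 2 * g1 * U) * hr
      - D.t T * (m * U + S * r) * hmU + 2 * g1 * m * D.t T * hmU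
      - 2 * m * r * D.t T * g * (hmUx + l * y * hmUv)
      - 2 * m * S * r * co1
      + 2 * m * r * (S * (-r ^ 2 * D.x (D.x X)) + r * S' + l * y * (r * S'')) * co
      + 2 * m * S * D.x f * hr
      - (D.x X * r + 1) * 2 * m * f * (S' + l * y * S'' - S * r * D.x (D.x X)) * hr

/-- The compatibility condition of the equations for `V_vv` and `V_xv`. -/
theorem Partials.Reduced.compat_x (S : D.Source f l y)
    (E : D.Reduced f l y g g1 g2 m T X U V k b) :
    2 * D.x f * D.v (D.v V) = -(D.x k * D.v V ^ 2) := by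
  have h1 := congrArg D.x E.vv
  have h2 := congrArg D.v E.xv
  simp only [map_sub, Derivation.leibniz, smul_eq_mul, D.vx, S.lx, S.fv, E.kv, E.bv,
    derivation_two, Derivation.map_one_eq_zero, mul_zero, add_zero, zero_add] at h1 h2
  refine (S.unit_l.mul E.unit_V).mul_left_cancel ?_
  linear_combination D.v V * h1 - l * D.v V * h2 - D.x (D.v V) * E.vv + l * D.v (D.v V) * E.xv

theorem Partials.Reduced.compat_x_mul (S : D.Source f l y)
    (E : D.Reduced f l y g g1 g2 m T X U V k b) :
    D.x f * (1 - k * l * D.v V) = -(D.x k * l * f * D.v V) := by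
  refine E.unit_V.mul_left_cancel ?_
  linear_combination l * f * E.compat_x S - D.x f * E.vv

theorem Partials.Reduced.Vvv_mul_fx (S : D.Source f l y)
    (E : D.Reduced f l y g g1 g2 m T X U V k b) : D.v (D.v V) * D.x f = 0 := by
  have h := congrArg D.v (E.compat_x_mul S)
  simp only [map_sub, map_neg, Derivation.leibniz, smul_eq_mul, D.vx, S.lv, S.fv, E.kv,
    Derivation.map_one_eq_zero, map_zero, mul_zero, add_zero] at h
  linear_combination D.v (D.v V) * E.compat_x_mul S - D.v V * h

/-- The Hopf–Cole alternative `V_vv ≠ 0` forces `f_t = 0` once `f_x = 0`, by the compatibility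
condition of the equations for `V_vv` and `V_t`. -/
theorem Partials.Reduced.Vvv_mul_ft (S : D.Source f l y)
    (E : D.Reduced f l y g g1 g2 m T X U V k b) (hf : D.x f = 0) :
    D.v (D.v V) * D.t f = 0 := by
  have kx : D.x k = 0 := by
    refine (E.unit_V.pow 2).mul_left_cancel ?_
    linear_combination E.compat_x S - 2 * D.v (D.v V) * hf
  have lt : D.t l = 0 := by rw [S.lt, hf, map_zero, zero_mul]
  have h0 := congrArg D.v E.tt
  have h1 := congrArg D.x E.xv
  have h1' := congrArg D.v E.xv
  have h2 := congrArg D.t E.vv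
  simp only [map_sub, map_add, Derivation.leibniz, Derivation.leibniz_pow, smul_eq_mul,
    nsmul_eq_mul, D.vx, D.vt, S.fv, E.kv, E.bv, kx, lt, hf,
    derivation_two, Derivation.map_one_eq_zero, mul_zero, add_zero, zero_add] at h0 h1 h1' h2
  push_cast at h0
  set s := b - k * D.x V with hs
  -- `2 V_tv = V_xv s - V_v s_x` with `s = b - k V_x`
  have ht : 2 * D.t (D.v V) = D.x (D.v V) * s - D.v V * (D.x b - k * D.x (D.x V)) := by
    linear_combination h0 - h1
  have htv := congrArg D.v ht
  simp only [map_sub, Derivation.leibniz, smul_eq_mul, hs, D.vx, D.vt, E.kv, E.bv,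
    map_zero, derivation_two, mul_zero, add_zero] at htv
  have key : 2 * D.t f * D.v (D.v V) = -(D.t k * D.v V ^ 2) := by
    refine (S.unit_l.mul E.unit_V).mul_left_cancel (eq_of_two_mul ?_)
    linear_combination 2 * D.v V * h2 - 2 * D.t (D.v V) * E.vv
      + (2 * l * f * D.v (D.v V) - k * l * D.v V ^ 2) * ht - 2 * l * f * D.v V * htv
      - l * k * D.v V ^ 2 * h1 - l * D.v V * s * h1' + l * D.v (D.v V) * s * E.xv
      + l * k * D.v V * D.x (D.v V) * E.xv
  have key' : D.t f * (1 - k * l * D.v V) = -(D.t k * l * f * D.v V) := by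
    refine E.unit_V.mul_left_cancel ?_
    linear_combination l * f * key - D.t f * E.vv
  have h := congrArg D.v key'
  simp only [map_sub, map_neg, Derivation.leibniz, smul_eq_mul, D.vt, S.lv, S.fv, E.kv,
    Derivation.map_one_eq_zero, map_zero, mul_zero, add_zero] at h
  linear_combination D.v (D.v V) * key' - D.v V * h

/-- The conclusion of the classification: `T = T(t)`, `X` is affine in `x`, `T_t U = X_t + u X_x`,
together with the two equations that `T` and `X` have to satisfy. -/
structure Partials.Classified (D : Partials A) (f y g T X U : A) : Prop where
  Tx : D.x T = 0
  Tu : D.u T = 0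
  Tv : D.v T = 0
  Xu : D.u X = 0
  Xv : D.v X = 0
  Uv : D.v U = 0
  Xxx : D.x (D.x X) = 0
  Udef : D.t T * U = D.t X + y * D.x X
  coeff : f * D.x X ^ 2 = D.t T * g
  Ttt : D.t (D.t T) * D.x X = 2 * D.t T * D.t (D.x X)
  Xtt : D.t (D.t X) * D.x X = 2 * D.t X * D.t (D.x X)
  unit_T : IsUnit (D.t T)
  unit_X : IsUnit (D.x X)

/-- If `V` is affine in `v`, then the reduced equations determine `U` and leave two equations for
`T` and `X`; the characteristic equations for `λ` and `λ'` enter here. -/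
theorem Partials.Reduced.classified (S : D.Source f l y) (R : D.Target g g1 g2 m T X)
    (E : D.Reduced f l y g g1 g2 m T X U V k b) (hV : D.v (D.v V) = 0) :
    D.Classified f y g T X U := by
  have hk : k * l * D.v V = 1 := by
    refine E.unit_V.mul_left_cancel ?_
    linear_combination E.vv - 2 * l * f * hV
  have unit_k : IsUnit k := IsUnit.of_mul_eq_one (l * D.v V) (by linear_combination hk)
  have kx : D.x k = 0 := by
    refine (E.unit_V.pow 2).mul_left_cancel ?_
    linear_combination E.compat_x S - 2 * D.x f * hV
  have hTx : D.x (D.t T) = 0 := by rw [D.xt, R.Tx, map_zero]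
  have Xxx : D.x (D.x X) = 0 := by
    have h := congrArg D.x E.kdef
    simp only [Derivation.leibniz, Derivation.leibniz_pow, smul_eq_mul, nsmul_eq_mul, R.mx, kx, hTx,
      mul_zero, add_zero] at h
    refine ((R.unit_m.mul unit_k).mul E.unit_X).mul_left_cancel (eq_of_two_mul ?_)
    push_cast at h
    linear_combination h
  have Vxv : D.x (D.v V) = 0 := by
    have h := congrArg D.x hk
    simp only [Derivation.leibniz, smul_eq_mul, S.lx, kx, Derivation.map_one_eq_zero,
      mul_zero, add_zero] at h
    refine (unit_k.mul S.unit_l).mul_left_cancel ?_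
    linear_combination h
  have hb : b = k * D.x V := by
    refine E.unit_V.mul_left_cancel ?_
    linear_combination 2 * f * Vxv - E.xv
  have hbX : k * D.x V * D.x X = D.t X := by
    linear_combination E.bdef - D.x X * hb + 3 * f * Xxx
  have Udef : D.t T * U = D.t X + y * D.x X := by
    linear_combination -U * E.kdef + k * D.x X * E.Udef + hbX + y * D.x X * hk
  have Uv : D.v U = 0 := by
    have h := congrArg D.v Udef
    simp only [map_add, Derivation.leibniz, smul_eq_mul, D.vt, D.vx, E.Xv, R.Tv, S.yv, map_zero,
      mul_zero, add_zero] at h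
    refine R.unit_T.mul_left_cancel ?_
    linear_combination h
  have kt : D.t k = -(D.x (D.x f) * k) := by
    have h0 := congrArg D.v E.tt
    simp only [map_sub, map_add, Derivation.leibniz, Derivation.leibniz_pow, smul_eq_mul,
      nsmul_eq_mul, D.vx, D.vt, S.fv, E.kv, E.bv, Vxv, map_zero, derivation_two,
      mul_zero, add_zero, sub_zero] at h0
    have hVt : D.t (D.v V) = 0 := eq_zero_of_two_mul (by linear_combination h0)
    have h := congrArg D.t hk
    simp only [Derivation.leibniz, smul_eq_mul, S.lt, hVt, Derivation.map_one_eq_zero] at h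
    refine (S.unit_l.mul E.unit_V).mul_left_cancel ?_
    linear_combination h
  have hg2 : D.t T * g2 = D.x (D.x f) := by
    have h := congrArg D.x E.coeff
    simp only [Derivation.leibniz, Derivation.leibniz_pow, smul_eq_mul, nsmul_eq_mul, Xxx, hTx,
      R.gx, mul_zero, add_zero, zero_add] at h
    have hg1 : D.t T * g1 = D.x f * D.x X := by
      refine E.unit_X.mul_left_cancel ?_
      linear_combination -h
    have h' := congrArg D.x hg1
    simp only [Derivation.leibniz, smul_eq_mul, Xxx, hTx, R.g1x, mul_zero, add_zero, zero_add] at h'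
    refine E.unit_X.mul_left_cancel ?_
    linear_combination h'
  refine ⟨R.Tx, R.Tu, R.Tv, E.Xu, E.Xv, Uv, Xxx, Udef, E.coeff, ?_, ?_, R.unit_T,
    E.unit_X⟩
  · have h := congrArg D.t E.kdef
    simp only [Derivation.leibniz, Derivation.leibniz_pow, smul_eq_mul, nsmul_eq_mul, R.mt,
      kt] at h
    push_cast at h
    linear_combination -D.x X * h + m * k * D.x X ^ 3 * hg2 + 2 * D.t (D.x X) * E.kdef
  · have hbXx := congrArg D.x hbX
    have hbXt := congrArg D.t hbX
    have hxx : k * D.x (D.x V) * D.x X = D.t (D.x X) := by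
      simp only [Derivation.leibniz, smul_eq_mul, kx, Xxx, D.xt] at hbXx
      linear_combination hbXx
    have hxxx : D.x (D.x (D.x V)) = 0 := by
      have h := congrArg D.x hxx
      simp only [Derivation.leibniz, smul_eq_mul, kx, Xxx, D.xt, map_zero, mul_zero, zero_add,
        add_zero] at h
      refine (unit_k.mul E.unit_X).mul_left_cancel ?_
      linear_combination h
    have h0 := congrArg D.x E.tt
    rw [hb] at h0
    simp only [map_sub, map_add, Derivation.leibniz, Derivation.leibniz_pow, smul_eq_mul,
      nsmul_eq_mul, D.xt, kx, hxxx, derivation_two, mul_zero, add_zero, zero_add] at h0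
    push_cast at h0
    simp only [Derivation.leibniz, smul_eq_mul, kt] at hbXt
    have h1 : D.t (D.x V) = k * D.x V * D.x (D.x V) + D.x (D.x f) * D.x V :=
      eq_of_two_mul (by linear_combination h0)
    linear_combination -D.x X * hbXt + k * D.x X ^ 2 * h1 + k * D.x V * D.x X * hxx
      + 2 * D.t (D.x X) * hbX

end Algebra

/-! ### The differential algebra of smooth functions -/

/-- The smooth functions on the open set `O` of the space of `(t,x,u,v)`, as functions on the
subtype `O` that are restrictions of a function on the whole space that is smooth on `O`. -/
def smoothSubalgebra (O : Opens E4) : Subalgebra ℝ (O → ℝ) where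
  carrier := {g | ∃ G : E4 → ℝ, ContDiffOn ℝ ∞ G O ∧ ∀ q : O, g q = G q}
  mul_mem' := by
    rintro a b ⟨G, hG, h⟩ ⟨G', hG', h'⟩
    exact ⟨fun q => G q * G' q, hG.mul hG', fun q => by simp [h, h']⟩
  add_mem' := by
    rintro a b ⟨G, hG, h⟩ ⟨G', hG', h'⟩
    exact ⟨fun q => G q + G' q, hG.add hG', fun q => by simp [h, h']⟩
  algebraMap_mem' r := ⟨fun _ => r, contDiffOn_const, fun _ => rfl⟩

/-- The algebra of smooth functions on the open set `O` of the space of `(t,x,u,v)`. -/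
def Sm (O : Opens E4) : Type := smoothSubalgebra O

instance (O : Opens E4) : CommRing (Sm O) := inferInstanceAs (CommRing (smoothSubalgebra O))

instance (O : Opens E4) : Algebra ℝ (Sm O) := inferInstanceAs (Algebra ℝ (smoothSubalgebra O))

namespace Sm

variable {O : Opens E4}

/-- The value of a smooth function at a point of its domain. -/
def val (g : Sm O) (q : O) : ℝ := (g : smoothSubalgebra O).1 q

@[ext] theorem ext {g h : Sm O} (H : ∀ q, g.val q = h.val q) : g = h :=
  Subtype.ext (funext H)

@[simp] theorem val_add (g h : Sm O) (q : O) : (g + h).val q = g.val q + h.val q := rfl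
@[simp] theorem val_sub (g h : Sm O) (q : O) : (g - h).val q = g.val q - h.val q := rfl
@[simp] theorem val_neg (g : Sm O) (q : O) : (-g).val q = -g.val q := rfl
@[simp] theorem val_mul (g h : Sm O) (q : O) : (g * h).val q = g.val q * h.val q := rfl
@[simp] theorem val_zero (q : O) : (0 : Sm O).val q = 0 := rfl
@[simp] theorem val_one (q : O) : (1 : Sm O).val q = 1 := rfl
@[simp] theorem val_two (q : O) : (2 : Sm O).val q = 2 := rfl
@[simp] theorem val_pow (g : Sm O) (n : ℕ) (q : O) : (g ^ n).val q = g.val q ^ n := rfl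

instance : IsReduced (Sm O) where
  eq_zero := by
    rintro g ⟨n, hn⟩
    ext q
    exact eq_zero_of_pow_eq_zero (by rw [← val_pow, hn]; rfl : g.val q ^ n = 0)

/-- The restriction to `O` of a function that is smooth on `O`. -/
def of (G : E4 → ℝ) (hG : ContDiffOn ℝ ∞ G O) : Sm O := ⟨fun q => G q, G, hG, fun _ => rfl⟩

@[simp] theorem val_of (G : E4 → ℝ) (hG : ContDiffOn ℝ ∞ G O) (q : O) : (of G hG).val q = G q :=
  rfl

/-- A function on the whole space that is smooth on `O` and restricts to `g`. -/
def rep (g : Sm O) : E4 → ℝ := g.2.choose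

theorem contDiffOn_rep (g : Sm O) : ContDiffOn ℝ ∞ g.rep O := g.2.choose_spec.1

theorem rep_apply (g : Sm O) (q : O) : g.rep q = g.val q := (g.2.choose_spec.2 q).symm

theorem contDiffAt_rep (g : Sm O) (q : O) : ContDiffAt ℝ ∞ g.rep q :=
  g.contDiffOn_rep.contDiffAt (O.isOpen.mem_nhds q.2)

theorem differentiableAt_rep (g : Sm O) (q : O) : DifferentiableAt ℝ g.rep q :=
  (g.contDiffAt_rep q).differentiableAt (by simp)

theorem rep_eventuallyEq (g : Sm O) {G : E4 → ℝ} (h : ∀ q : O, g.val q = G q) (q : O) :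
    g.rep =ᶠ[nhds (q : E4)] G := by
  filter_upwards [O.isOpen.mem_nhds q.2] with p hp
  exact (g.rep_apply ⟨p, hp⟩).trans (h ⟨p, hp⟩)

theorem contDiffOn_fderiv (G : E4 → ℝ) (hG : ContDiffOn ℝ ∞ G O) (e : E4) :
    ContDiffOn ℝ ∞ (fun q => fderiv ℝ G q e) O :=
  (hG.fderiv_of_isOpen O.isOpen (m := ∞) (by simp)).clm_apply contDiffOn_const

/-- The derivative in the constant direction `e`. -/
def dirFun (e : E4) (g : Sm O) : Sm O := of _ (contDiffOn_fderiv _ g.contDiffOn_rep e)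

theorem val_dirFun (e : E4) (g : Sm O) {G : E4 → ℝ} (h : ∀ q : O, g.val q = G q) (q : O) :
    (dirFun e g).val q = fderiv ℝ G q e := by
  rw [dirFun, val_of, (g.rep_eventuallyEq h q).fderiv_eq]

/-- The derivative in the constant direction `e`, as a derivation. -/
def dir (e : E4) : Derivation ℝ (Sm O) (Sm O) :=
  Derivation.mk'
    { toFun := dirFun e
      map_add' := fun g h => by
        ext q
        rw [val_dirFun e (g + h) (G := fun p => g.rep p + h.rep p)
            (fun q => by simp [rep_apply]),
          fderiv_fun_add (g.differentiableAt_rep q) (h.differentiableAt_rep q)]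
        rfl
      map_smul' := fun r g => by
        ext q
        rw [val_dirFun e (r • g) (G := fun p => r • g.rep p)
            (fun q => by rw [rep_apply]; rfl),
          fderiv_fun_const_smul (g.differentiableAt_rep q)]
        rfl }
    (fun g h => by
      ext q
      show (dirFun e (g * h)).val q = _
      rw [val_dirFun e (g * h) (G := fun p => g.rep p * h.rep p)
          (fun q => by simp [rep_apply]),
        fderiv_fun_mul (g.differentiableAt_rep q) (h.differentiableAt_rep q)]
      simp only [smul_eq_mul, add_apply, smul_apply,
        rep_apply]
      rfl)

theorem val_dir (e : E4) (g : Sm O) {G : E4 → ℝ} (h : ∀ q : O, g.val q = G q) (q : O) :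
    (dir e g).val q = fderiv ℝ G q e := val_dirFun e g h q

@[simp] theorem val_dir_of (e : E4) (G : E4 → ℝ) (hG : ContDiffOn ℝ ∞ G O) (q : O) :
    (dir e (of G hG)).val q = fderiv ℝ G q e := val_dir e _ (fun _ => rfl) q

theorem dir_comm (e e' : E4) (g : Sm O) : dir e (dir e' g) = dir e' (dir e g) := by
  have key : ∀ (e e' : E4) (q : O),
      (dir e (dir e' g)).val q = fderiv ℝ (fderiv ℝ g.rep) q e e' := by
    intro e e' q
    rw [val_dir e (dir e' g) (G := fun p => fderiv ℝ g.rep p e') (fun p => rfl)]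
    have hd : DifferentiableAt ℝ (fderiv ℝ g.rep) (q : E4) :=
      ((g.contDiffAt_rep q).fderiv_right (m := 1) (by norm_cast)).differentiableAt (by simp)
    rw [fderiv_clm_apply hd (differentiableAt_const _)]
    simp
  ext q
  rw [key, key]
  refine (g.contDiffAt_rep q).isSymmSndFDerivAt ?_ e e'
  rw [minSmoothness_of_isRCLikeNormedField]
  norm_cast

/-- The partial derivatives with respect to `t, x, u, v`. -/
def partials (O : Opens E4) : Partials (Sm O) where
  t := dir (1, 0, 0, 0)
  x := dir (0, 1, 0, 0)
  u := dir (0, 0, 1, 0)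
  v := dir (0, 0, 0, 1)
  xt := dir_comm _ _
  ut := dir_comm _ _
  vt := dir_comm _ _
  ux := dir_comm _ _
  vx := dir_comm _ _
  vu := dir_comm _ _

theorem isUnit_of_ne_zero {g : Sm O} (h : ∀ q, g.val q ≠ 0) : IsUnit g := by
  refine IsUnit.of_mul_eq_one (of (fun q => (g.rep q)⁻¹) (g.contDiffOn_rep.inv ?_)) ?_
  · intro q hq
    rw [g.rep_apply ⟨q, hq⟩]
    exact h _
  · ext q
    simp [rep_apply, h q]

theorem fderiv_eq (g : Sm O) (q : O) (a b c d : ℝ) {G : E4 → ℝ} (h : ∀ q : O, g.val q = G q) :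
    fderiv ℝ G q (a, b, c, d) = a * ((partials O).t g).val q + b * ((partials O).x g).val q +
      c * ((partials O).u g).val q + d * ((partials O).v g).val q := by
  simp only [partials, val_dir _ g h]
  rw [← smul_eq_mul, ← smul_eq_mul, ← smul_eq_mul, ← smul_eq_mul, ← map_smul, ← map_smul,
    ← map_smul, ← map_smul, ← map_add, ← map_add, ← map_add]
  simp

theorem eventually_ne {g : Sm O} {q : O} (h : g.val q ≠ 0) :
    ∀ᶠ p in nhds (q : E4), ∃ hp : p ∈ O, g.val ⟨p, hp⟩ ≠ 0 := by
  have hc := (g.contDiffAt_rep q).continuousAt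
  rw [← rep_apply] at h
  filter_upwards [O.isOpen.mem_nhds q.2, hc.eventually_ne h] with p hp hne
  exact ⟨hp, by rwa [← rep_apply]⟩

end Sm

/-! ### The projection to the `(t,x)`-plane and the derivatives of `f` -/

/-- The projection to the space of `(t,x)`, as a continuous linear map. -/
def base : E4 →L[ℝ] ℝ × ℝ :=
  (ContinuousLinearMap.fst ℝ ℝ _).prod
    ((ContinuousLinearMap.fst ℝ ℝ _).comp (ContinuousLinearMap.snd ℝ ℝ _))

theorem isOpenMap_base : IsOpenMap base := by
  have : (base : E4 → ℝ × ℝ) = Prod.map id Prod.fst := rfl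
  rw [this]
  exact IsOpenMap.id.prodMap isOpenMap_fst

section Coeff

variable (F : Coeff)

theorem deriv_snd {f : ℝ × ℝ → ℝ} {t x : ℝ} (h : DifferentiableAt ℝ f (t, x)) :
    deriv (fun y => f (t, y)) x = fderiv ℝ f (t, x) (0, 1) :=
  (h.hasFDerivAt.comp_hasDerivAt x ((hasDerivAt_const x t).prodMk (hasDerivAt_id x))).deriv

theorem Coeff.fx_eq {p : ℝ × ℝ} (hp : p ∈ F.dom) : F.fx p.1 p.2 = fderiv ℝ F.f p (0, 1) :=
  deriv_snd ((F.smooth.contDiffAt (F.isOpen_dom.mem_nhds hp)).differentiableAt (by simp))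

theorem Coeff.smooth_fx : ContDiffOn ℝ ∞ (fun p : ℝ × ℝ => F.fx p.1 p.2) F.dom :=
  ((F.smooth.fderiv_of_isOpen F.isOpen_dom (m := ∞) (by simp)).clm_apply
    (contDiffOn_const (c := ((0 : ℝ), (1 : ℝ))))).congr fun _ hp => F.fx_eq hp

theorem Coeff.fxx_eq {p : ℝ × ℝ} (hp : p ∈ F.dom) :
    F.fxx p.1 p.2 = fderiv ℝ (fun p : ℝ × ℝ => F.fx p.1 p.2) p (0, 1) := by
  rw [← deriv_snd ((F.smooth_fx.contDiffAt (F.isOpen_dom.mem_nhds hp)).differentiableAt (by simp)),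
    Coeff.fxx, iteratedDeriv_succ, iteratedDeriv_one]
  rfl

theorem Coeff.smooth_fxx : ContDiffOn ℝ ∞ (fun p : ℝ × ℝ => F.fxx p.1 p.2) F.dom :=
  ((F.smooth_fx.fderiv_of_isOpen F.isOpen_dom (m := ∞) (by simp)).clm_apply
    (contDiffOn_const (c := ((0 : ℝ), (1 : ℝ))))).congr fun _ hp => F.fxx_eq hp

end Coeff

/-! ### Linear algebra of two-planes -/

/-- The value of `α ∧ β` on the plane of the space of `(t,x,u,v)` that is spanned by
`∂_t + s ∂_u + (a - c r) ∂_v` and `∂_x + r ∂_u + w ∂_v`. -/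
def wedge (a c w : ℝ) (α β : ℝ × ℝ × ℝ × ℝ) (s r : ℝ) : ℝ :=
  (α.1 + s * α.2.2.1 + (a - c * r) * α.2.2.2) * (β.2.1 + r * β.2.2.1 + w * β.2.2.2) -
    (α.2.1 + r * α.2.2.1 + w * α.2.2.2) * (β.1 + s * β.2.2.1 + (a - c * r) * β.2.2.2)

/-- If the product of two polynomial functions of the form `wedge` vanishes identically, then one
of them does. -/
theorem wedge_eq_zero_or {a c w : ℝ} {α β α' β' : ℝ × ℝ × ℝ × ℝ}
    (h : ∀ s r, wedge a c w α β s r = 0 ∨ wedge a c w α' β' s r = 0) :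
    (∀ s r, wedge a c w α β s r = 0) ∨ ∀ s r, wedge a c w α' β' s r = 0 := by
  by_contra! hne
  obtain ⟨⟨s₀, r₀, h₀⟩, s₁, r₁, h₁⟩ := hne
  open Polynomial in
  -- restriction to the line through `(s₀,r₀)` and `(s₁,r₁)`
  have line : ∀ α β : ℝ × ℝ × ℝ × ℝ, ∃ p : ℝ[X], ∀ x,
      wedge a c w α β (s₀ + x * (s₁ - s₀)) (r₀ + x * (r₁ - r₀)) = p.eval x := fun α β =>
    ⟨(C α.1 + (C s₀ + X * C (s₁ - s₀)) * C α.2.2.1 +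
        (C a - C c * (C r₀ + X * C (r₁ - r₀))) * C α.2.2.2) *
        (C β.2.1 + (C r₀ + X * C (r₁ - r₀)) * C β.2.2.1 + C w * C β.2.2.2) -
      (C α.2.1 + (C r₀ + X * C (r₁ - r₀)) * C α.2.2.1 + C w * C α.2.2.2) *
        (C β.1 + (C s₀ + X * C (s₁ - s₀)) * C β.2.2.1 +
          (C a - C c * (C r₀ + X * C (r₁ - r₀))) * C β.2.2.2),
      fun x => by simp [wedge]⟩
  obtain ⟨p, hp⟩ := line α β
  obtain ⟨p', hp'⟩ := line α' β'
  have hpp : p * p' = 0 := Polynomial.funext fun x => by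
    rw [Polynomial.eval_mul, ← hp, ← hp', Polynomial.eval_zero, mul_eq_zero]
    exact h _ _
  rcases mul_eq_zero.1 hpp with rfl | rfl
  · exact h₀ (by simpa using hp 0)
  · exact h₁ (by simpa using hp' 1)

/-- The pairing of a covector with a vector. -/
def pair (α e : ℝ × ℝ × ℝ × ℝ) : ℝ :=
  e.1 * α.1 + e.2.1 * α.2.1 + e.2.2.1 * α.2.2.1 + e.2.2.2 * α.2.2.2

/-- A decomposable two-form `α ∧ β ≠ 0` that vanishes on all planes of the two-parameter family
defined by a potential system with `f ≠ 0` is annihilated by `∂_u` and `∂_x + λ u ∂_v`. -/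
theorem eq_zero_of_wedge {a c w : ℝ} (hc : c ≠ 0) {α β : ℝ × ℝ × ℝ × ℝ}
    (h : ∀ s r, wedge a c w α β s r = 0) {e e' : ℝ × ℝ × ℝ × ℝ}
    (he : pair α e * pair β e' - pair α e' * pair β e ≠ 0) :
    α.2.2.1 = 0 ∧ α.2.1 + w * α.2.2.2 = 0 := by
  obtain ⟨αt, αx, αu, αv⟩ := α
  obtain ⟨βt, βx, βu, βv⟩ := β
  obtain ⟨et, ex, eu, ev⟩ := e
  obtain ⟨et', ex', eu', ev'⟩ := e'
  simp only [wedge, pair] at *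
  have h00 := h 0 0
  have h10 := h 1 0
  have h01 := h 0 1
  have h02 := h 0 (-1)
  -- components in the frame `∂_t + a ∂_v, ∂_x + w ∂_v, ∂_u, ∂_v`
  obtain ⟨αT, hαT⟩ : ∃ z, z = αt + a * αv := ⟨_, rfl⟩
  obtain ⟨βT, hβT⟩ : ∃ z, z = βt + a * βv := ⟨_, rfl⟩
  obtain ⟨αX, hαX⟩ : ∃ z, z = αx + w * αv := ⟨_, rfl⟩
  obtain ⟨βX, hβX⟩ : ∃ z, z = βx + w * βv := ⟨_, rfl⟩
  obtain rfl : αt = αT - a * αv := by linarith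
  obtain rfl : βt = βT - a * βv := by linarith
  obtain rfl : αx = αX - w * αv := by linarith
  obtain rfl : βx = βX - w * βv := by linarith
  have htx : αT * βX - αX * βT = 0 := by linear_combination h00
  have hxu : αu * βX - αX * βu = 0 := by linear_combination h10 - h00
  have huv : αu * βv - αv * βu = 0 := by
    refine (mul_right_injective₀ hc) ?_
    linear_combination (1 / 2) * (h01 + h02) - h00
  have htu : αT * βu - αu * βT = c * (αv * βX - αX * βv) := by
    linear_combination (1 / 2) * (h01 - h02)
  have hxv : αv * βX - αX * βv = 0 := by
    have : c * (αv * βX - αX * βv) ^ 2 = 0 := by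
      linear_combination -(αv * βX - αX * βv) * htu - (αu * βv - αv * βu) * htx
        + (αT * βv - αv * βT) * hxu
    rcases mul_eq_zero.1 this with h | h
    · exact absurd h hc
    · exact pow_eq_zero_iff (two_ne_zero) |>.1 h
  rw [hxv, mul_zero] at htu
  have hm : αT * βv - αv * βT ≠ 0 := by
    intro hm
    apply he
    linear_combination (et * ex' - ex * et') * htx - (ex * eu' - eu * ex') * hxu +
      (et * eu' - eu * et') * htu +
      (et * (ev' - a * et' - w * ex') - (ev - a * et - w * ex) * et') * hm -
      (ex * (ev' - a * et' - w * ex') - (ev - a * et - w * ex) * ex') * hxv +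
      (eu * (ev' - a * et' - w * ex') - (ev - a * et - w * ex) * eu') * huv
  constructor
  · refine (mul_right_injective₀ hm) ?_
    linear_combination αT * huv + αv * htu
  · refine (mul_right_injective₀ hm) ?_
    linear_combination -αT * hxv + αv * htx

/-- A linear map with nonzero determinant takes every value. -/
theorem exists_eq_of_det_ne_zero {E : Type*} [NormedAddCommGroup E] [NormedSpace ℝ E]
    [FiniteDimensional ℝ E] {L : E →L[ℝ] E} (h : L.det ≠ 0) (w : E) : ∃ e, L e = w :=
  (LinearMap.equivOfDetNeZero (L : E →ₗ[ℝ] E) h).surjective w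

/-! ### Coefficients as smooth functions -/

variable {O : Opens E4}

/-- The composition of a smooth function of `(t,x)` with a pair of smooth functions. -/
def Sm.comp₂ {f : ℝ × ℝ → ℝ} {W : Set (ℝ × ℝ)} (hf : ContDiffOn ℝ ∞ f W) (T X : Sm O)
    (h : ∀ q, (T.val q, X.val q) ∈ W) : Sm O :=
  Sm.of (fun q => f (T.rep q, X.rep q)) (hf.comp (T.contDiffOn_rep.prodMk X.contDiffOn_rep)
    fun q hq => by simpa only [Sm.rep_apply _ ⟨q, hq⟩] using h ⟨q, hq⟩)

@[simp] theorem Sm.val_comp₂ {f : ℝ × ℝ → ℝ} {W : Set (ℝ × ℝ)} (hf : ContDiffOn ℝ ∞ f W)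
    (T X : Sm O) (h : ∀ q, (T.val q, X.val q) ∈ W) (q : O) :
    (Sm.comp₂ hf T X h).val q = f (T.val q, X.val q) := by
  simp only [comp₂, val_of, rep_apply]

theorem Sm.val_dir_comp₂ {f : ℝ × ℝ → ℝ} {W : Set (ℝ × ℝ)} (hW : IsOpen W)
    (hf : ContDiffOn ℝ ∞ f W) (T X : Sm O) (h : ∀ q, (T.val q, X.val q) ∈ W) (e : E4) (q : O) :
    (Sm.dir e (Sm.comp₂ hf T X h)).val q =
      (Sm.dir e T).val q * fderiv ℝ f (T.val q, X.val q) (1, 0) +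
      (Sm.dir e X).val q * fderiv ℝ f (T.val q, X.val q) (0, 1) := by
  have hd : DifferentiableAt ℝ f (T.rep q, X.rep q) := by
    rw [rep_apply, rep_apply]
    exact (hf.contDiffAt (hW.mem_nhds (h q))).differentiableAt (by simp)
  rw [comp₂, val_dir_of, fderiv_fun_comp (g := f) (f := fun q => (T.rep q, X.rep q)) _ hd
    ((T.differentiableAt_rep q).prodMk (X.differentiableAt_rep q)),
    DifferentiableAt.fderiv_prodMk (T.differentiableAt_rep q) (X.differentiableAt_rep q)]
  rw [val_dir e T (G := T.rep) (fun q => (T.rep_apply q).symm),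
    val_dir e X (G := X.rep) (fun q => (X.rep_apply q).symm), ← smul_eq_mul, ← smul_eq_mul,
    ← map_smul, ← map_smul, ← map_add, rep_apply, rep_apply]
  simp

/-- The composition of a smooth function of `t` with a smooth function. -/
def Sm.comp₁ {f : ℝ → ℝ} {W : Set ℝ} (hf : ContDiffOn ℝ ∞ f W) (T : Sm O)
    (h : ∀ q, T.val q ∈ W) : Sm O :=
  Sm.of (fun q => f (T.rep q)) (hf.comp T.contDiffOn_rep
    fun q hq => by simpa only [Sm.rep_apply _ ⟨q, hq⟩] using h ⟨q, hq⟩)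

@[simp] theorem Sm.val_comp₁ {f : ℝ → ℝ} {W : Set ℝ} (hf : ContDiffOn ℝ ∞ f W) (T : Sm O)
    (h : ∀ q, T.val q ∈ W) (q : O) : (Sm.comp₁ hf T h).val q = f (T.val q) := by
  simp only [comp₁, val_of, rep_apply]

theorem Sm.val_dir_comp₁ {f : ℝ → ℝ} {W : Set ℝ} (hf : ContDiffOn ℝ ∞ f W) (T : Sm O)
    (h : ∀ q, T.val q ∈ W) (e : E4) (q : O) {f' : ℝ} (hd : HasDerivAt f f' (T.val q)) :
    (Sm.dir e (Sm.comp₁ hf T h)).val q = f' * (Sm.dir e T).val q := by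
  rw [← rep_apply] at hd
  rw [comp₁, val_dir_of, val_dir e T (G := T.rep) (fun q => (T.rep_apply q).symm)]
  have := (hd.comp_hasFDerivAt (q : E4) (T.differentiableAt_rep q).hasFDerivAt).fderiv
  exact (congrArg (fun L => L e) this)

namespace Sm

theorem contDiffOn_coord : ContDiffOn ℝ ∞ (fun q : E4 => q.1) O ∧
    ContDiffOn ℝ ∞ (fun q : E4 => q.2.1) O ∧ ContDiffOn ℝ ∞ (fun q : E4 => q.2.2.1) O :=
  ⟨contDiff_fst.contDiffOn, (contDiff_fst.comp contDiff_snd).contDiffOn,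
    (contDiff_fst.comp (contDiff_snd.comp contDiff_snd)).contDiffOn⟩

/-- The coordinate function `t`. -/
def ct (O : Opens E4) : Sm O := of (fun q => q.1) contDiffOn_coord.1

/-- The coordinate function `x`. -/
def cx (O : Opens E4) : Sm O := of (fun q => q.2.1) contDiffOn_coord.2.1

/-- The coordinate function `u`. -/
def cu (O : Opens E4) : Sm O := of (fun q => q.2.2.1) contDiffOn_coord.2.2

theorem dir_ct (e : E4) (q : O) : (dir e (ct O)).val q = e.1 := by
  rw [ct, val_dir_of]
  exact congrArg (fun L => L e) (ContinuousLinearMap.fst ℝ ℝ (ℝ × ℝ × ℝ)).fderiv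

theorem dir_cx (e : E4) (q : O) : (dir e (cx O)).val q = e.2.1 := by
  rw [cx, val_dir_of]
  exact congrArg (fun L => L e) ((ContinuousLinearMap.fst ℝ ℝ (ℝ × ℝ)).comp
    (ContinuousLinearMap.snd ℝ ℝ (ℝ × ℝ × ℝ))).fderiv

theorem dir_cu (e : E4) (q : O) : (dir e (cu O)).val q = e.2.2.1 := by
  rw [cu, val_dir_of]
  exact congrArg (fun L => L e) ((ContinuousLinearMap.fst ℝ ℝ ℝ).comp
    ((ContinuousLinearMap.snd ℝ ℝ (ℝ × ℝ)).comp
    (ContinuousLinearMap.snd ℝ ℝ (ℝ × ℝ × ℝ)))).fderiv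

end Sm

namespace Coeff

variable (F : Coeff) {lam : ℝ → ℝ} {T X : Sm O} (h : ∀ q, (T.val q, X.val q) ∈ F.dom)

/-- The function `f(T,X)`. -/
def at₀ : Sm O := Sm.comp₂ F.smooth T X h

/-- The function `f_x(T,X)`. -/
def at₁ : Sm O := Sm.comp₂ F.smooth_fx T X h

/-- The function `f_xx(T,X)`. -/
def at₂ : Sm O := Sm.comp₂ F.smooth_fxx T X h

/-- The function `λ(T)`. -/
def atChar (hl : F.IsCharacteristic lam) : Sm O :=
  Sm.comp₁ hl.smooth T fun q => Set.mem_image_of_mem Prod.fst (h q)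

theorem dir_at₀ (e : E4) (hT : Sm.dir e T = 0) :
    Sm.dir e (F.at₀ h) = F.at₁ h * Sm.dir e X := by
  ext q
  rw [at₀, Sm.val_dir_comp₂ F.isOpen_dom, hT, ← F.fx_eq (h q)]
  simp [at₁, mul_comm]

theorem dir_at₁ (e : E4) (hT : Sm.dir e T = 0) :
    Sm.dir e (F.at₁ h) = F.at₂ h * Sm.dir e X := by
  ext q
  rw [at₁, Sm.val_dir_comp₂ F.isOpen_dom, hT, ← F.fxx_eq (h q)]
  simp [at₂, mul_comm]

theorem dir_atChar (hl : F.IsCharacteristic lam) (e : E4) :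
    Sm.dir e (F.atChar h hl) = F.at₂ h * F.atChar h hl * Sm.dir e T := by
  ext q
  rw [atChar, Sm.val_dir_comp₁ _ _ _ _ _ (hl.ode _ _ (h q))]
  simp [at₂]

theorem isUnit_atChar (hl : F.IsCharacteristic lam) : IsUnit (F.atChar h hl) :=
  Sm.isUnit_of_ne_zero fun q => by
    rw [atChar, Sm.val_comp₁]
    exact hl.ne_zero _ ⟨_, h q, rfl⟩

theorem target (hl : F.IsCharacteristic lam) (Tx : (Sm.partials O).x T = 0)
    (Tu : (Sm.partials O).u T = 0) (Tv : (Sm.partials O).v T = 0)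
    (unit_T : IsUnit ((Sm.partials O).t T)) :
    (Sm.partials O).Target (F.at₀ h) (F.at₁ h) (F.at₂ h) (F.atChar h hl) T X where
  Tx := Tx
  Tu := Tu
  Tv := Tv
  gx := F.dir_at₀ h _ Tx
  gu := F.dir_at₀ h _ Tu
  g1x := F.dir_at₁ h _ Tx
  mt := F.dir_atChar h hl _
  mx := by rw [Sm.partials, F.dir_atChar h hl, show Sm.dir _ T = 0 from Tx, mul_zero]
  mu := by rw [Sm.partials, F.dir_atChar h hl, show Sm.dir _ T = 0 from Tu, mul_zero]
  mv := by rw [Sm.partials, F.dir_atChar h hl, show Sm.dir _ T = 0 from Tv, mul_zero]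
  unit_m := F.isUnit_atChar h hl
  unit_T := unit_T

variable (hO : ∀ q : O, ((Sm.ct O).val q, (Sm.cx O).val q) ∈ F.dom)

theorem regular_at₀ (a : Sm O) (ha : F.at₀ hO * a = 0) : a = 0 := by
  ext q
  by_contra hq
  obtain ⟨W, hW, hWo, hqW⟩ := eventually_nhds_iff.1 (Sm.eventually_ne hq)
  obtain ⟨p, ⟨r, hr, rfl⟩, hp⟩ := F.ne_zero (base '' W)
    (by rintro _ ⟨r, hr, rfl⟩; exact hO ⟨r, (hW r hr).1⟩) (isOpenMap_base W hWo) ⟨_, q, hqW, rfl⟩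
  obtain ⟨hrO, hne⟩ := hW r hr
  have : (F.at₀ hO).val ⟨r, hrO⟩ * a.val ⟨r, hrO⟩ = 0 :=
    congrArg (fun g : Sm O => g.val ⟨r, hrO⟩) ha
  rcases mul_eq_zero.1 this with h | h
  · rw [at₀, Sm.val_comp₂] at h
    exact hp h
  · exact hne h

theorem source (hl : F.IsCharacteristic lam) :
    (Sm.partials O).Source (F.at₀ hO) (F.atChar hO hl) (Sm.cu O) ∧
      (Sm.partials O).x (F.at₀ hO) = F.at₁ hO := by
  have fx : (Sm.partials O).x (F.at₀ hO) = F.at₁ hO := by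
    rw [Sm.partials, F.dir_at₀ hO _ (Sm.ext fun q => Sm.dir_ct _ q),
      show Sm.dir _ (Sm.cx O) = 1 from Sm.ext fun q => Sm.dir_cx _ q, mul_one]
  have fxx : (Sm.partials O).x (F.at₁ hO) = F.at₂ hO := by
    rw [Sm.partials, F.dir_at₁ hO _ (Sm.ext fun q => Sm.dir_ct _ q),
      show Sm.dir _ (Sm.cx O) = 1 from Sm.ext fun q => Sm.dir_cx _ q, mul_one]
  refine ⟨?_, fx⟩
  constructor
  · rw [Sm.partials, F.dir_at₀ hO _ (Sm.ext fun q => Sm.dir_ct _ q),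
      show Sm.dir _ (Sm.cx O) = 0 from Sm.ext fun q => Sm.dir_cx _ q, mul_zero]
  · rw [Sm.partials, F.dir_at₀ hO _ (Sm.ext fun q => Sm.dir_ct _ q),
      show Sm.dir _ (Sm.cx O) = 0 from Sm.ext fun q => Sm.dir_cx _ q, mul_zero]
  · rw [fx, fxx, Sm.partials, F.dir_atChar hO hl,
      show Sm.dir _ (Sm.ct O) = 1 from Sm.ext fun q => Sm.dir_ct _ q, mul_one]
  · rw [Sm.partials, F.dir_atChar hO hl,
      show Sm.dir _ (Sm.ct O) = 0 from Sm.ext fun q => Sm.dir_ct _ q, mul_zero]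
  · rw [Sm.partials, F.dir_atChar hO hl,
      show Sm.dir _ (Sm.ct O) = 0 from Sm.ext fun q => Sm.dir_ct _ q, mul_zero]
  · rw [Sm.partials, F.dir_atChar hO hl,
      show Sm.dir _ (Sm.ct O) = 0 from Sm.ext fun q => Sm.dir_ct _ q, mul_zero]
  · exact Sm.ext fun q => Sm.dir_cu _ q
  · exact Sm.ext fun q => Sm.dir_cu _ q
  · exact Sm.ext fun q => Sm.dir_cu _ q
  · exact Sm.ext fun q => Sm.dir_cu _ q
  · exact F.regular_at₀ hO
  · exact F.isUnit_atChar hO hl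

end Coeff

/-- The covector `da` at `q`. -/
def Sm.cov {O : Opens E4} (a : Sm O) (q : O) : ℝ × ℝ × ℝ × ℝ :=
  (((Sm.partials O).t a).val q, ((Sm.partials O).x a).val q, ((Sm.partials O).u a).val q,
    ((Sm.partials O).v a).val q)

theorem Sm.fderiv_eq_pair {O : Opens E4} (a : Sm O) {G : E4 → ℝ}
    (hG : ∀ q : O, a.val q = G q) (q : O) (e : E4) : fderiv ℝ G q e = pair (a.cov q) e :=
  Sm.fderiv_eq a q e.1 e.2.1 e.2.2.1 e.2.2.2 hG

/-! ### The components of a potential admissible transformation -/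

namespace IsPotentialAdmissible

variable {F F' : Coeff} {lam lam' : ℝ → ℝ} {Ω : Set E4} {φ : E4 → E4}
  (h : IsPotentialAdmissible F lam F' lam' Ω φ)

/-- The domain of the transformation. -/
def opens : Opens E4 := ⟨Ω, h.point.isOpen⟩

/-- The component `T`. -/
def T : Sm h.opens := Sm.of (potT φ) (contDiff_fst.comp_contDiffOn h.point.smooth)

/-- The component `X`. -/
def X : Sm h.opens :=
  Sm.of (potX φ) ((contDiff_fst.comp contDiff_snd).comp_contDiffOn h.point.smooth)

/-- The component `U`. -/
def U : Sm h.opens :=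
  Sm.of (potU φ) ((contDiff_fst.comp (contDiff_snd.comp contDiff_snd)).comp_contDiffOn
    h.point.smooth)

/-- The component `V`. -/
def V : Sm h.opens :=
  Sm.of (potV φ) ((contDiff_snd.comp (contDiff_snd.comp contDiff_snd)).comp_contDiffOn
    h.point.smooth)

theorem mem_source (q : h.opens) : ((Sm.ct h.opens).val q, (Sm.cx h.opens).val q) ∈ F.dom :=
  h.source q q.2

theorem mem_target (q : h.opens) : (h.T.val q, h.X.val q) ∈ F'.dom := h.target q q.2

/-- The differentials of the components take arbitrary values simultaneously. -/
theorem exists_pair_eq (q : h.opens) (a b c d : ℝ) : ∃ e, pair (h.T.cov q) e = a ∧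
    pair (h.X.cov q) e = b ∧ pair (h.U.cov q) e = c ∧ pair (h.V.cov q) e = d := by
  obtain ⟨e, he⟩ := exists_eq_of_det_ne_zero (h.point.jacobian_ne_zero q q.2) (a, b, c, d)
  have hd : DifferentiableAt ℝ φ q :=
    (h.point.smooth.contDiffAt (h.point.isOpen.mem_nhds q.2)).differentiableAt (by simp)
  have hT : fderiv ℝ (potT φ) q = (ContinuousLinearMap.fst ℝ ℝ _).comp (fderiv ℝ φ q) :=
    ((ContinuousLinearMap.fst ℝ ℝ (ℝ × ℝ × ℝ)).hasFDerivAt.comp _ hd.hasFDerivAt).fderiv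
  have hX : fderiv ℝ (potX φ) q = ((ContinuousLinearMap.fst ℝ ℝ _).comp
      (ContinuousLinearMap.snd ℝ ℝ _)).comp (fderiv ℝ φ q) :=
    (((ContinuousLinearMap.fst ℝ ℝ (ℝ × ℝ)).comp
      (ContinuousLinearMap.snd ℝ ℝ _)).hasFDerivAt.comp _ hd.hasFDerivAt).fderiv
  have hU : fderiv ℝ (potU φ) q = ((ContinuousLinearMap.fst ℝ ℝ _).comp
      ((ContinuousLinearMap.snd ℝ ℝ _).comp (ContinuousLinearMap.snd ℝ ℝ _))).comp
      (fderiv ℝ φ q) :=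
    (((ContinuousLinearMap.fst ℝ ℝ ℝ).comp ((ContinuousLinearMap.snd ℝ ℝ _).comp
      (ContinuousLinearMap.snd ℝ ℝ _))).hasFDerivAt.comp _ hd.hasFDerivAt).fderiv
  have hV : fderiv ℝ (potV φ) q = ((ContinuousLinearMap.snd ℝ ℝ _).comp
      ((ContinuousLinearMap.snd ℝ ℝ _).comp (ContinuousLinearMap.snd ℝ ℝ _))).comp
      (fderiv ℝ φ q) :=
    (((ContinuousLinearMap.snd ℝ ℝ ℝ).comp ((ContinuousLinearMap.snd ℝ ℝ _).comp
      (ContinuousLinearMap.snd ℝ ℝ _))).hasFDerivAt.comp _ hd.hasFDerivAt).fderiv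
  refine ⟨e, ?_, ?_, ?_, ?_⟩
  · rw [← Sm.fderiv_eq_pair h.T (G := potT φ) (fun _ => rfl), hT]; simp [he]
  · rw [← Sm.fderiv_eq_pair h.X (G := potX φ) (fun _ => rfl), hX]; simp [he]
  · rw [← Sm.fderiv_eq_pair h.U (G := potU φ) (fun _ => rfl), hU]; simp [he]
  · rw [← Sm.fderiv_eq_pair h.V (G := potV φ) (fun _ => rfl), hV]; simp [he]

/-- The value of `α ∧ β` on the plane through `q` in the source system with parameters
`u_t = s`, `u_x = r`. -/
def solWedge (hl : F.IsCharacteristic lam) (q : h.opens) (α β : ℝ × ℝ × ℝ × ℝ) (s r : ℝ) : ℝ :=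
  wedge (-(F.atChar h.mem_source hl).val q * ((Sm.cu h.opens).val q ^ 2 / 2 -
      (F.at₁ h.mem_source).val q * (Sm.cu h.opens).val q))
    ((F.atChar h.mem_source hl).val q * (F.at₀ h.mem_source).val q)
    ((F.atChar h.mem_source hl).val q * (Sm.cu h.opens).val q) α β s r

/-- The target system, pulled back to the jets of the source system. -/
theorem pulled_back (hl : F.IsCharacteristic lam) (hl' : F'.IsCharacteristic lam') (q : h.opens)
    (s r : ℝ) (hJ : h.solWedge hl q (h.T.cov q) (h.X.cov q) s r ≠ 0) :
    h.solWedge hl q (h.T.cov q) (h.V.cov q) s r =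
      (F'.atChar h.mem_target hl').val q * h.U.val q *
        h.solWedge hl q (h.T.cov q) (h.X.cov q) s r ∧
    2 * h.solWedge hl q (h.V.cov q) (h.X.cov q) s r =
      -(F'.atChar h.mem_target hl').val q *
        ((h.U.val q ^ 2 - 2 * (F'.at₁ h.mem_target).val q * h.U.val q) *
          h.solWedge hl q (h.T.cov q) (h.X.cov q) s r +
        2 * (F'.at₀ h.mem_target).val q *
          h.solWedge hl q (h.T.cov q) (h.U.cov q) s r) := by
  have hlv : (F.atChar h.mem_source hl).val q = lam (q : E4).1 := by
    rw [Coeff.atChar, Sm.val_comp₁]; rfl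
  have hf : (F.at₀ h.mem_source).val q = F.f ((q : E4).1, (q : E4).2.1) := by
    rw [Coeff.at₀, Sm.val_comp₂]; rfl
  have hf1 : (F.at₁ h.mem_source).val q = F.fx (q : E4).1 (q : E4).2.1 := by
    rw [Coeff.at₁, Sm.val_comp₂]; rfl
  have hm : (F'.atChar h.mem_target hl').val q = lam' (potT φ q) := by
    rw [Coeff.atChar, Sm.val_comp₁]; rfl
  have hg : (F'.at₀ h.mem_target).val q = F'.f (potT φ q, potX φ q) := by
    rw [Coeff.at₀, Sm.val_comp₂]; rfl
  have hg1 : (F'.at₁ h.mem_target).val q = F'.fx (potT φ q) (potX φ q) := by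
    rw [Coeff.at₁, Sm.val_comp₂]; rfl
  have hy : (Sm.cu h.opens).val q = (q : E4).2.2.1 := rfl
  set a := -(F.atChar h.mem_source hl).val q * ((Sm.cu h.opens).val q ^ 2 / 2 -
      (F.at₁ h.mem_source).val q * (Sm.cu h.opens).val q) with ha
  set c := (F.atChar h.mem_source hl).val q * (F.at₀ h.mem_source).val q with hc
  set w := (F.atChar h.mem_source hl).val q * (Sm.cu h.opens).val q with hw
  let z : PotJet := ⟨q, s, r, a - c * r, w⟩
  have hDt : ∀ (g : Sm h.opens) (G : E4 → ℝ), (∀ q : h.opens, g.val q = G q) →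
      z.Dt G = (g.cov q).1 + s * (g.cov q).2.2.1 + (a - c * r) * (g.cov q).2.2.2 := by
    intro g G hG
    refine (Sm.fderiv_eq_pair g hG q _).trans ?_
    simp only [pair, z]
    ring
  have hDx : ∀ (g : Sm h.opens) (G : E4 → ℝ), (∀ q : h.opens, g.val q = G q) →
      z.Dx G = (g.cov q).2.1 + r * (g.cov q).2.2.1 + w * (g.cov q).2.2.2 := by
    intro g G hG
    refine (Sm.fderiv_eq_pair g hG q _).trans ?_
    simp only [pair, z]
    ring
  have hW : ∀ (g g' : Sm h.opens) (G G' : E4 → ℝ), (∀ q : h.opens, g.val q = G q) →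
      (∀ q : h.opens, g'.val q = G' q) →
      z.Dt G * z.Dx G' - z.Dx G * z.Dt G' = h.solWedge hl q (g.cov q) (g'.cov q) s r := by
    intro g g' G G' hG hG'
    rw [hDt g G hG, hDx g G hG, hDt g' G' hG', hDx g' G' hG', solWedge, wedge]
  have hTX := hW h.T h.X (potT φ) (potX φ) (fun _ => rfl) (fun _ => rfl)
  have hTU := hW h.T h.U (potT φ) (potU φ) (fun _ => rfl) (fun _ => rfl)
  have hTV := hW h.T h.V (potT φ) (potV φ) (fun _ => rfl) (fun _ => rfl)
  have hVX := hW h.V h.X (potV φ) (potX φ) (fun _ => rfl) (fun _ => rfl)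
  have hJ' : potTotalJac φ z ≠ 0 := by rwa [potTotalJac, hTX]
  have hz : F.PotentialSystem lam z := by
    refine ⟨?_, ?_⟩
    · simp only [z, hw, hlv, hy]
    · simp only [z, ha, hc, hlv, hy, hf, hf1]
      ring
  obtain ⟨e1, e2⟩ := (h.maps z q.2 hJ').1 hz
  simp only [potProlong, potNewDx, potNewDt, hTX, hTU, hTV, hVX, potTotalJac] at e1 e2
  change _ = lam' (potT φ q) * potU φ q at e1
  change _ = -lam' (potT φ q) * ((potU φ q) ^ 2 / 2 + F'.f (potT φ q, potX φ q) * _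
    - F'.fx (potT φ q) (potX φ q) * potU φ q) at e2
  rw [← hm] at e1 e2
  rw [← hg, ← hg1] at e2
  have hUv : h.U.val q = potU φ q := rfl
  rw [hUv]
  field_simp at e1 e2
  exact ⟨by linear_combination e1, by linear_combination e2⟩

end IsPotentialAdmissible

/-! ### The determining equations -/

theorem Sm.val_dir_congr {O O' : Opens E4} (hO : O' ≤ O) {a : Sm O} {a' : Sm O'}
    (haa : ∀ q : O', a'.val q = a.val ⟨q, hO q.2⟩) (e : E4) (q : O') :
    (Sm.dir e a').val q = (Sm.dir e a).val ⟨q, hO q.2⟩ := by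
  rw [Sm.val_dir e a (G := a.rep) (fun q => (a.rep_apply q).symm),
    Sm.val_dir e a' (G := a.rep) (fun q => by rw [haa, ← Sm.rep_apply])]

theorem Sm.val_eq_zero {O : Opens E4} {a : Sm O} (ha : a = 0) (q : O) : a.val q = 0 := by
  rw [ha, Sm.val_zero]

namespace IsPotentialAdmissible

variable {F F' : Coeff} {lam lam' : ℝ → ℝ} {Ω : Set E4} {φ : E4 → E4}
  (h : IsPotentialAdmissible F lam F' lam' Ω φ)

/-- The component `T` depends on `t` only: `dT ∧ dX` or `dT ∧ (dV - λ'(T) U dX)` vanishes on the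
solution planes through a point. -/
theorem T_eq (hl : F.IsCharacteristic lam) (hl' : F'.IsCharacteristic lam') :
    (Sm.partials h.opens).x h.T = 0 ∧ (Sm.partials h.opens).u h.T = 0 ∧
      (Sm.partials h.opens).v h.T = 0 := by
  have S := (F.source h.mem_source hl).1
  have key : ∀ q, (F.at₀ h.mem_source).val q ≠ 0 → ((Sm.partials h.opens).u h.T).val q = 0 ∧
      ((Sm.partials h.opens).x h.T + F.atChar h.mem_source hl * Sm.cu h.opens *
        (Sm.partials h.opens).v h.T).val q = 0 := by
    intro q hf
    have hc : (F.atChar h.mem_source hl).val q * (F.at₀ h.mem_source).val q ≠ 0 := by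
      refine mul_ne_zero ?_ hf
      rw [Coeff.atChar, Sm.val_comp₁]
      exact hl.ne_zero _ ⟨_, h.mem_source q, rfl⟩
    set n := (F'.atChar h.mem_target hl').val q * h.U.val q with hn
    have hlin : ∀ α s r, h.solWedge hl q α (h.V.cov q - n • h.X.cov q) s r =
        h.solWedge hl q α (h.V.cov q) s r - n * h.solWedge hl q α (h.X.cov q) s r := by
      intro α s r
      simp only [solWedge, wedge, Prod.fst_sub, Prod.snd_sub, Prod.smul_fst, Prod.smul_snd,
        smul_eq_mul]
      ring
    have hor : (∀ s r, h.solWedge hl q (h.T.cov q) (h.X.cov q) s r = 0) ∨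
        ∀ s r, h.solWedge hl q (h.T.cov q) (h.V.cov q - n • h.X.cov q) s r = 0 := by
      refine wedge_eq_zero_or fun s r => or_iff_not_imp_left.2 fun hJ => ?_
      have := (h.pulled_back hl hl' q s r hJ).1
      refine (hlin _ s r).trans ?_
      rw [this, hn]
      ring
    obtain ⟨e, e1, e2, -, e4⟩ := h.exists_pair_eq q 1 0 0 0
    rcases hor with hw | hw
    · obtain ⟨e', e1', e2', -, -⟩ := h.exists_pair_eq q 0 1 0 0
      exact eq_zero_of_wedge hc hw (e := e) (e' := e') (by rw [e1, e2, e1', e2']; norm_num)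
    · obtain ⟨e', e1', e2', -, e4'⟩ := h.exists_pair_eq q 0 0 0 1
      have hpair : ∀ e, pair (h.V.cov q - n • h.X.cov q) e =
          pair (h.V.cov q) e - n * pair (h.X.cov q) e := by
        intro e
        simp only [pair, Prod.fst_sub, Prod.snd_sub, Prod.smul_fst, Prod.smul_snd, smul_eq_mul]
        ring
      exact eq_zero_of_wedge hc hw (e := e) (e' := e')
        (by rw [hpair, hpair, e1, e2, e4, e1', e2', e4']; norm_num)
  have hu : (Sm.partials h.opens).u h.T = 0 := S.regular _ <| Sm.ext fun q => by
    by_cases hf : (F.at₀ h.mem_source).val q = 0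
    · simp [hf]
    · simp [(key q hf).1]
  have hx : (Sm.partials h.opens).x h.T + F.atChar h.mem_source hl * Sm.cu h.opens *
        (Sm.partials h.opens).v h.T = 0 := S.regular _ <| Sm.ext fun q => by
    by_cases hf : (F.at₀ h.mem_source).val q = 0
    · simp [hf]
    · rw [Sm.val_mul, (key q hf).2, mul_zero, Sm.val_zero]
  have := S.mul_eq_zero_of_bracket (p := 1) (a := h.T) (by rw [hu, mul_zero])
    (by rw [hx, mul_zero])
  rw [one_mul, one_mul] at this
  exact ⟨this.1, hu, this.2⟩

theorem pair_T (hl : F.IsCharacteristic lam) (hl' : F'.IsCharacteristic lam') (q : h.opens)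
    (e : E4) : pair (h.T.cov q) e = e.1 * ((Sm.partials h.opens).t h.T).val q := by
  obtain ⟨hx, hu, hv⟩ := h.T_eq hl hl'
  simp [pair, Sm.cov, hx, hu, hv]

theorem Tt_ne_zero (hl : F.IsCharacteristic lam) (hl' : F'.IsCharacteristic lam')
    (q : h.opens) : ((Sm.partials h.opens).t h.T).val q ≠ 0 := by
  obtain ⟨e, e1, -⟩ := h.exists_pair_eq q 1 0 0 0
  rw [h.pair_T hl hl'] at e1
  exact right_ne_zero_of_mul (e1 ▸ one_ne_zero)

theorem targetData (hl : F.IsCharacteristic lam) (hl' : F'.IsCharacteristic lam') :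
    (Sm.partials h.opens).Target (F'.at₀ h.mem_target) (F'.at₁ h.mem_target)
      (F'.at₂ h.mem_target) (F'.atChar h.mem_target hl') h.T h.X := by
  obtain ⟨hx, hu, hv⟩ := h.T_eq hl hl'
  exact F'.target _ _ hx hu hv (Sm.isUnit_of_ne_zero (h.Tt_ne_zero hl hl'))

/-- On the solution planes, `v'_x' = λ' u'` means `D_x V = λ'(T) U D_x X`. -/
theorem space_eq (hl : F.IsCharacteristic lam) (hl' : F'.IsCharacteristic lam') :
    (Sm.partials h.opens).x h.V +
        F.atChar h.mem_source hl * Sm.cu h.opens * (Sm.partials h.opens).v h.V =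
      F'.atChar h.mem_target hl' * h.U * ((Sm.partials h.opens).x h.X +
        F.atChar h.mem_source hl * Sm.cu h.opens * (Sm.partials h.opens).v h.X) ∧
    (Sm.partials h.opens).u h.V =
      F'.atChar h.mem_target hl' * h.U * (Sm.partials h.opens).u h.X := by
  have S := (F.source h.mem_source hl).1
  obtain ⟨Tx, Tu, Tv⟩ := h.T_eq hl hl'
  obtain ⟨P₀, hP₀⟩ : ∃ P, P = (Sm.partials h.opens).x h.V +
        F.atChar h.mem_source hl * Sm.cu h.opens * (Sm.partials h.opens).v h.V -
      F'.atChar h.mem_target hl' * h.U * ((Sm.partials h.opens).x h.X +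
        F.atChar h.mem_source hl * Sm.cu h.opens * (Sm.partials h.opens).v h.X) := ⟨_, rfl⟩
  obtain ⟨P₁, hP₁⟩ : ∃ P, P = (Sm.partials h.opens).u h.V -
      F'.atChar h.mem_target hl' * h.U * (Sm.partials h.opens).u h.X := ⟨_, rfl⟩
  obtain ⟨a, ha⟩ : ∃ a, a = (Sm.partials h.opens).x h.X +
    F.atChar h.mem_source hl * Sm.cu h.opens * (Sm.partials h.opens).v h.X := ⟨_, rfl⟩
  obtain ⟨b, hb⟩ : ∃ b, b = (Sm.partials h.opens).u h.X := ⟨_, rfl⟩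
  have key : ∀ q r, (a.val q + r * b.val q) * (P₀.val q + r * P₁.val q) = 0 := by
    intro q r
    have hT : ∀ G : Sm h.opens, h.solWedge hl q (h.T.cov q) (G.cov q) 0 r =
        ((Sm.partials h.opens).t h.T).val q *
          (((Sm.partials h.opens).x G + F.atChar h.mem_source hl * Sm.cu h.opens *
            (Sm.partials h.opens).v G).val q + r * ((Sm.partials h.opens).u G).val q) := by
      intro G
      simp only [solWedge, wedge, Sm.cov, Tx, Tu, Tv, Sm.val_zero, Sm.val_add, Sm.val_mul]
      ring
    by_cases hJ : a.val q + r * b.val q = 0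
    · rw [hJ, zero_mul]
    · have hJ' : h.solWedge hl q (h.T.cov q) (h.X.cov q) 0 r ≠ 0 := by
        rw [hT, ← ha, ← hb]
        exact mul_ne_zero (h.Tt_ne_zero hl hl' q) hJ
      have h1 := (h.pulled_back hl hl' q 0 r hJ').1
      rw [hT, hT] at h1
      have : P₀.val q + r * P₁.val q = 0 := by
        refine (mul_right_injective₀ (h.Tt_ne_zero hl hl' q)) ?_
        simp only [hP₀, hP₁, Sm.val_add, Sm.val_sub, Sm.val_mul] at h1 ⊢
        linear_combination h1
      rw [this, mul_zero]
  have k0 : P₀ * a = 0 := Sm.ext fun q => by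
    simp only [Sm.val_mul, Sm.val_zero]
    linear_combination key q 0
  have k1 : P₁ * b = 0 := Sm.ext fun q => by
    simp only [Sm.val_mul, Sm.val_zero]
    linear_combination (1 / 2) * (key q 1 + key q (-1)) - key q 0
  have k2 : P₀ * b + P₁ * a = 0 := Sm.ext fun q => by
    simp only [Sm.val_mul, Sm.val_zero, Sm.val_add]
    linear_combination (1 / 2) * (key q 1 - key q (-1))
  have k3 : P₀ * b = 0 := by
    refine IsReduced.eq_zero _ ⟨2, ?_⟩
    linear_combination P₀ * b * k2 - b * P₁ * k0
  have k4 : P₁ * a = 0 := by linear_combination k2 - k3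
  have hz : ∀ P : Sm h.opens, P * a = 0 → P * b = 0 → P = 0 := by
    intro P h1 h2
    rw [hb] at h2
    rw [ha] at h1
    obtain ⟨h3, h4⟩ := S.mul_eq_zero_of_bracket h2 h1
    ext q
    by_contra hq
    obtain ⟨e, e1, e2, -⟩ := h.exists_pair_eq q 0 1 0 0
    rw [h.pair_T hl hl', mul_eq_zero, or_iff_left (h.Tt_ne_zero hl hl' q)] at e1
    have hx : ((Sm.partials h.opens).x h.X).val q = 0 :=
      (mul_eq_zero.1 (Sm.val_eq_zero h3 q)).resolve_left hq
    have hu : ((Sm.partials h.opens).u h.X).val q = 0 :=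
      (mul_eq_zero.1 (Sm.val_eq_zero h2 q)).resolve_left hq
    have hv : ((Sm.partials h.opens).v h.X).val q = 0 :=
      (mul_eq_zero.1 (Sm.val_eq_zero h4 q)).resolve_left hq
    simp [pair, Sm.cov, e1, hx, hu, hv] at e2
  exact ⟨sub_eq_zero.1 (hP₀ ▸ hz _ k0 k3), sub_eq_zero.1 (hP₁ ▸ hz _ k4 k1)⟩

/-- The determining equations of the transformation. -/
theorem determining (hl : F.IsCharacteristic lam) (hl' : F'.IsCharacteristic lam') :
    (Sm.partials h.opens).Determining (F.at₀ h.mem_source) (F.atChar h.mem_source hl)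
      (Sm.cu h.opens) (F'.at₀ h.mem_target) (F'.at₁ h.mem_target) (F'.atChar h.mem_target hl')
      h.T h.X h.U h.V := by
  obtain ⟨S, fx⟩ := F.source h.mem_source hl
  obtain ⟨Tx, Tu, Tv⟩ := h.T_eq hl hl'
  obtain ⟨space, hVu⟩ := h.space_eq hl hl'
  have hl0 : ∀ q, (F.atChar h.mem_source hl).val q ≠ 0 := fun q => by
    rw [Coeff.atChar, Sm.val_comp₁]
    exact hl.ne_zero _ ⟨_, h.mem_source q, rfl⟩
  set D := Sm.partials h.opens with hD
  set l := F.atChar h.mem_source hl with hl_def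
  set f := F.at₀ h.mem_source with hf_def
  set f₁ := F.at₁ h.mem_source with hf₁_def
  set y := Sm.cu h.opens with hy_def
  set m := F'.atChar h.mem_target hl' with hm_def
  set g := F'.at₀ h.mem_target with hg_def
  set g₁ := F'.at₁ h.mem_target with hg₁_def
  have hTt : ∀ q, (D.t h.T).val q ≠ 0 := h.Tt_ne_zero hl hl'
  have spaceq : ∀ q, (D.x h.V).val q + l.val q * y.val q * (D.v h.V).val q =
      m.val q * h.U.val q * ((D.x h.X).val q + l.val q * y.val q * (D.v h.X).val q) := fun q =>
    congrArg (fun a : Sm h.opens => a.val q) space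
  have hVuq : ∀ q, (D.u h.V).val q = m.val q * h.U.val q * (D.u h.X).val q := fun q =>
    congrArg (fun a : Sm h.opens => a.val q) hVu
  have hK : ∀ q, (D.v h.V - m * h.U * D.v h.X).val q ≠ 0 := by
    intro q hq
    obtain ⟨e, e1, e2, -, e4⟩ := h.exists_pair_eq q 0 0 0 1
    rw [h.pair_T hl hl', mul_eq_zero, or_iff_left (h.Tt_ne_zero hl hl' q)] at e1
    simp only [pair, Sm.cov, e1] at e2 e4
    simp only [Sm.val_sub, Sm.val_mul] at hq
    refine one_ne_zero (α := ℝ) ?_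
    linear_combination -e4 + m.val q * h.U.val q * e2 + e.2.1 * spaceq q + e.2.2.1 * hVuq q +
      (e.2.2.2 - e.2.1 * l.val q * y.val q) * hq
  -- the second equation of the target system, as a polynomial in `u_x`
  have key : ∀ q r, (D.x h.X + l * y * D.v h.X).val q + r * (D.u h.X).val q ≠ 0 →
      ((D.x h.X + l * y * D.v h.X).val q + r * (D.u h.X).val q) *
        ((2 * (D.t h.V - m * h.U * D.t h.X) -
          l * (y ^ 2 - 2 * D.x f * y) * (D.v h.V - m * h.U * D.v h.X)).val q -
          2 * l.val q * f.val q * r * (D.v h.V - m * h.U * D.v h.X).val q) +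
      (m * D.t h.T).val q * ((h.U ^ 2 - 2 * g₁ * h.U).val q *
          ((D.x h.X + l * y * D.v h.X).val q + r * (D.u h.X).val q) +
        2 * g.val q * ((D.x h.U + l * y * D.v h.U).val q + r * (D.u h.U).val q)) = 0 := by
    intro q r hJ
    have hT : ∀ G : Sm h.opens, h.solWedge hl q (h.T.cov q) (G.cov q) 0 r =
        (D.t h.T).val q * ((D.x G + l * y * D.v G).val q + r * (D.u G).val q) := by
      intro G
      simp only [solWedge, wedge, Sm.cov, Tx, Tu, Tv, Sm.val_zero, Sm.val_add, Sm.val_mul,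
        ← hD, ← hl_def, ← hy_def]
      ring
    have hJ' : h.solWedge hl q (h.T.cov q) (h.X.cov q) 0 r ≠ 0 := by
      rw [hT]
      exact mul_ne_zero (hTt q) hJ
    have h2 := (h.pulled_back hl hl' q 0 r hJ').2
    rw [hT, hT] at h2
    simp only [solWedge, wedge, Sm.cov, ← hD, ← hl_def, ← hy_def, ← hf_def, ← hf₁_def, ← hg_def,
      ← hg₁_def, ← hm_def] at h2
    rw [fx]
    simp only [Sm.val_sub, Sm.val_mul, Sm.val_add, Sm.val_pow, Sm.val_two] at h2 ⊢
    linear_combination h2 + 2 * ((D.t h.X).val q + (-l.val q *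
      (y.val q ^ 2 / 2 - f₁.val q * y.val q) - l.val q * f.val q * r) * (D.v h.X).val q) * (spaceq q + r * hVuq q)
  have hXu : D.u h.X = 0 := S.regular _ <| Sm.ext fun q => by
    rw [Sm.val_mul, Sm.val_zero]
    by_contra hne
    have hb := right_ne_zero_of_mul hne
    obtain ⟨a, ha⟩ : ∃ a, a = (D.x h.X + l * y * D.v h.X).val q := ⟨_, rfl⟩
    have hk : ∀ k : ℝ, a + (k - a / (D.u h.X).val q) * (D.u h.X).val q = k * (D.u h.X).val q := by
      intro k
      field_simp
      ring
    -- The polynomial in `u_x` vanishes off one point, so its second difference there is zero.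
    have hk' := fun (k : ℝ) (h0 : k ≠ 0) => key q (k - a / (D.u h.X).val q) (by
      rw [← ha, hk]; exact mul_ne_zero h0 hb)
    simp only [← ha, hk] at hk'
    have h1 := hk' 1 (by norm_num)
    have h2 := hk' 2 (by norm_num)
    have h3 := hk' 3 (by norm_num)
    refine mul_ne_zero (mul_ne_zero (hl0 q) (hK q)) hne ?_
    linear_combination (-1 / 4) * (h1 - 2 * h2 + h3)
  have hVu' : D.u h.V = 0 := by rw [hVu, hXu, mul_zero]
  have ha : ∀ q, (D.x h.X + l * y * D.v h.X).val q ≠ 0 := by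
    intro q hq
    obtain ⟨e, e1, e2, -, e4⟩ := h.exists_pair_eq q 0 1 0 (m.val q * h.U.val q)
    rw [h.pair_T hl hl', mul_eq_zero, or_iff_left (h.Tt_ne_zero hl hl' q)] at e1
    have hXuq := Sm.val_eq_zero hXu q
    have hVuq := Sm.val_eq_zero hVu' q
    have hKq := hK q
    simp only [pair, Sm.cov, ← hD, e1, hXuq, hVuq] at e2 e4
    simp only [Sm.val_sub, Sm.val_mul, Sm.val_add] at hq hKq
    have : e.2.2.2 - l.val q * y.val q * e.2.1 = 0 := by
      refine mul_right_injective₀ hKq ?_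
      linear_combination e4 - m.val q * h.U.val q * e2 - e.2.1 * spaceq q
    refine one_ne_zero (α := ℝ) ?_
    linear_combination -e2 + e.2.1 * hq + (D.v h.X).val q * this
  have key' : ∀ q r, _ := fun q r => key q r (by
    rw [Sm.val_eq_zero hXu q, mul_zero, add_zero]; exact ha q)
  refine ⟨hXu, hVu', space, ?_, ?_, Sm.isUnit_of_ne_zero ha, Sm.isUnit_of_ne_zero hK⟩
  · ext q
    have h1 := key' q 1
    have h2 := key' q (-1)
    rw [Sm.val_eq_zero hXu q] at h1 h2
    simp only [Sm.val_sub, Sm.val_mul, Sm.val_add, Sm.val_pow, Sm.val_two] at h1 h2 ⊢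
    linear_combination (-1 / 4) * (h1 - h2)
  · ext q
    have h1 := key' q 0
    rw [Sm.val_eq_zero hXu q] at h1
    simp only [Sm.val_sub, Sm.val_mul, Sm.val_add, Sm.val_pow, Sm.val_two, Sm.val_neg] at h1 ⊢
    linear_combination h1

theorem mono (h : IsPotentialAdmissible F lam F' lam' Ω φ) {W : Set E4} (hW : IsOpen W)
    (hWΩ : W ⊆ Ω) :
    IsPotentialAdmissible F lam F' lam' W φ where
  point := ⟨hW, h.point.smooth.mono hWΩ, fun p hp => h.point.jacobian_ne_zero p (hWΩ hp)⟩
  source q hq := h.source q (hWΩ hq)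
  target q hq := h.target q (hWΩ hq)
  maps z hz := h.maps z (hWΩ hz)

/-- The component `V` is affine in `v`: where `V_vv ≠ 0`, the coefficient `f` would be locally
constant. -/
theorem V_vv (hF : F.MemL2) (hl : F.IsCharacteristic lam) (hl' : F'.IsCharacteristic lam') :
    (Sm.partials h.opens).v ((Sm.partials h.opens).v h.V) = 0 := by
  ext q
  by_contra hq
  obtain ⟨ε, hε, hball⟩ := Metric.eventually_nhds_iff_ball.1 (Sm.eventually_ne hq)
  have hsub : Metric.ball (q : E4) ε ⊆ Ω := fun p hp => (hball p hp).1
  have h' := h.mono Metric.isOpen_ball hsub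
  have hle : h'.opens ≤ h.opens := hsub
  have S := (F.source h'.mem_source hl).1
  have R := h'.targetData hl hl'
  obtain ⟨k, b, E⟩ := (h'.determining hl hl').reduced S R
  have hunit : IsUnit ((Sm.partials h'.opens).v ((Sm.partials h'.opens).v h'.V)) :=
    Sm.isUnit_of_ne_zero fun p => by
      have := Sm.val_dir_congr hle (Sm.val_dir_congr hle (a := h.V) (a' := h'.V) (fun _ => rfl)
        (0, 0, 0, 1)) (0, 0, 0, 1) p
      exact this ▸ (hball p p.2).2
  have fx : (Sm.partials h'.opens).x (F.at₀ h'.mem_source) = 0 :=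
    (hunit.mul_right_eq_zero).1 (E.Vvv_mul_fx S)
  have ft : (Sm.partials h'.opens).t (F.at₀ h'.mem_source) = 0 :=
    (hunit.mul_right_eq_zero).1 (E.Vvv_mul_ft S fx)
  have hval : ∀ p : h'.opens, (F.at₀ h'.mem_source).val p = F.f (base p) := fun p => by
    rw [Coeff.at₀, Sm.val_comp₂]; rfl
  have hconst : ∀ p ∈ Metric.ball (q : E4) ε, F.f (base p) = F.f (base q) := by
    intro p hp
    have hd : DifferentiableOn ℝ (fun p => F.f (base p)) (Metric.ball (q : E4) ε) :=
      (F.smooth.comp base.contDiff.contDiffOn fun p hp => h'.source p hp).differentiableOn (by simp)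
    refine (convex_ball (q : E4) ε).is_const_of_fderivWithin_eq_zero hd (fun r hr => ?_) hp
      (Metric.mem_ball_self hε)
    rw [fderivWithin_of_isOpen Metric.isOpen_ball hr]
    refine ContinuousLinearMap.ext fun e => ?_
    rw [Sm.fderiv_eq_pair (F.at₀ h'.mem_source) hval ⟨r, hr⟩ e]
    simp [pair, Sm.cov, fx, ft, S.fu, S.fv]
  exact hF.nonconst (base '' Metric.ball (q : E4) ε)
    (by rintro _ ⟨p, hp, rfl⟩; exact h'.source p hp)
    (isOpenMap_base _ Metric.isOpen_ball) ⟨_, q, Metric.mem_ball_self hε, rfl⟩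
    ⟨F.f (base q), by rintro _ ⟨p, hp, rfl⟩; exact hconst p hp⟩

theorem classified (hF : F.MemL2) (hl : F.IsCharacteristic lam) (hl' : F'.IsCharacteristic lam') :
    (Sm.partials h.opens).Classified (F.at₀ h.mem_source) (Sm.cu h.opens)
      (F'.at₀ h.mem_target) h.T h.X h.U := by
  have S := (F.source h.mem_source hl).1
  have R := h.targetData hl hl'
  obtain ⟨k, b, E⟩ := (h.determining hl hl').reduced S R
  exact E.classified S R (h.V_vv hF hl hl')

end IsPotentialAdmissible

/-! ### Restriction to a slice `v = const` -/

/-- The embedding of the space of `(t,x,u)` as the hyperplane `v = c`. -/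
def lift (c : ℝ) (y : E3) : E4 := (y.1, y.2.1, y.2.2, c)

/-- The linear part of `lift c`. -/
def liftLin : E3 →L[ℝ] E4 :=
  (ContinuousLinearMap.fst ℝ ℝ _).prod (((ContinuousLinearMap.fst ℝ ℝ _).comp
    (ContinuousLinearMap.snd ℝ ℝ _)).prod (((ContinuousLinearMap.snd ℝ ℝ _).comp
    (ContinuousLinearMap.snd ℝ ℝ _)).prod 0))

theorem hasFDerivAt_lift (c : ℝ) (y : E3) : HasFDerivAt (lift c) liftLin y := by
  have h : lift c = fun y => liftLin y + (0, 0, 0, c) := by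
    funext y
    simp [lift, liftLin]
  rw [h]
  exact liftLin.hasFDerivAt.add_const _

theorem contDiff_lift (c : ℝ) : ContDiff ℝ ∞ (lift c) :=
  contDiff_fst.prodMk ((contDiff_fst.comp contDiff_snd).prodMk
    ((contDiff_snd.comp contDiff_snd).prodMk contDiff_const))

theorem contDiff_proj : ContDiff ℝ ∞ proj :=
  contDiff_fst.prodMk ((contDiff_fst.comp contDiff_snd).prodMk
    (contDiff_fst.comp (contDiff_snd.comp contDiff_snd)))

theorem lift_proj_mem_ball {p q : E4} {r : ℝ} (hq : q ∈ Metric.ball p r) :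
    lift p.2.2.2 (proj q) ∈ Metric.ball p r := by
  simp only [Metric.mem_ball, Prod.dist_eq, lift, proj, sup_lt_iff, dist_self] at hq ⊢
  exact ⟨hq.1, hq.2.1, hq.2.2.1, lt_of_le_of_lt dist_nonneg hq.1⟩

theorem proj_image_ball (p : E4) (r : ℝ) :
    proj '' Metric.ball p r = lift p.2.2.2 ⁻¹' Metric.ball p r := by
  ext y
  constructor
  · rintro ⟨q, hq, rfl⟩
    exact lift_proj_mem_ball hq
  · exact fun hy => ⟨_, hy, rfl⟩

theorem isOpen_proj_image_ball (p : E4) (r : ℝ) : IsOpen (proj '' Metric.ball p r) := by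
  rw [proj_image_ball]
  exact Metric.isOpen_ball.preimage (contDiff_lift _).continuous

/-- The transformation or vector field of the space of `(t,x,u)` given by the `(t,x,u)`-components
on the hyperplane `v = c`. -/
def slice (φ : E4 → E4) (c : ℝ) (y : E3) : E3 := proj (φ (lift c y))

theorem contDiffOn_slice {φ : E4 → E4} {Ω : Set E4} (hφ : ContDiffOn ℝ ∞ φ Ω) {p : E4} {r : ℝ}
    (hball : Metric.ball p r ⊆ Ω) :
    ContDiffOn ℝ ∞ (slice φ p.2.2.2) (proj '' Metric.ball p r) := by
  rw [proj_image_ball]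
  exact contDiff_proj.comp_contDiffOn (hφ.comp (contDiff_lift _).contDiffOn fun y hy => hball hy)

theorem Sm.differentiableAt_lift {O : Opens E4} (a : Sm O) {c : ℝ} {y : E3} (hy : lift c y ∈ O) :
    DifferentiableAt ℝ (fun y => a.rep (lift c y)) y :=
  ((a.differentiableAt_rep ⟨_, hy⟩).hasFDerivAt.comp y (hasFDerivAt_lift c y)).differentiableAt

theorem Sm.fderiv_lift {O : Opens E4} (a : Sm O) {G : E4 → ℝ} (hG : ∀ q : O, a.val q = G q)
    {c : ℝ} {y : E3} (hy : lift c y ∈ O) (e : E3) :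
    fderiv ℝ (fun y => G (lift c y)) y e =
      pair (a.cov ⟨lift c y, hy⟩) (e.1, e.2.1, e.2.2, 0) := by
  have hd : DifferentiableAt ℝ G (lift c y) :=
    (a.differentiableAt_rep ⟨_, hy⟩).congr_of_eventuallyEq (a.rep_eventuallyEq hG ⟨_, hy⟩).symm
  have := (hd.hasFDerivAt.comp y (hasFDerivAt_lift c y)).fderiv
  rw [← Sm.fderiv_eq_pair a hG]
  exact congrArg (fun L => L e) this

/-- A smooth function whose `v`-derivative vanishes does not depend on `v` within a ball of the
sup norm. -/
theorem Sm.eq_on_slice {O : Opens E4} {a : Sm O} (ha : (Sm.partials O).v a = 0) {G : E4 → ℝ}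
    (hG : ∀ q : O, a.val q = G q) {p : E4} {r : ℝ} (hball : Metric.ball p r ⊆ O) {q : E4}
    (hq : q ∈ Metric.ball p r) : G q = G (lift p.2.2.2 (proj q)) := by
  have hmem : ∀ s ∈ Metric.ball p.2.2.2 r, lift s (proj q) ∈ O := by
    intro s hs
    apply hball
    simp only [Metric.mem_ball, Prod.dist_eq, lift, proj, sup_lt_iff] at hq hs ⊢
    exact ⟨hq.1, hq.2.1, hq.2.2.1, hs⟩
  have hd : ∀ s ∈ Metric.ball p.2.2.2 r, HasDerivAt (fun s => a.rep (lift s (proj q))) 0 s := by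
    intro s hs
    have h1 := (a.differentiableAt_rep ⟨_, hmem s hs⟩).hasFDerivAt
    have h2 : HasDerivAt (fun s => lift s (proj q)) (0, 0, 0, 1) s :=
      (hasDerivAt_const _ _).prodMk ((hasDerivAt_const _ _).prodMk
        ((hasDerivAt_const _ _).prodMk (hasDerivAt_id s)))
    have h3 := h1.comp_hasDerivAt s h2
    rwa [← Sm.val_dir (0, 0, 0, 1) a (G := a.rep) (fun q => (a.rep_apply q).symm) ⟨_, hmem s hs⟩,
      show Sm.dir (0, 0, 0, 1) a = 0 from ha, Sm.val_zero] at h3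
  have hqv : q.2.2.2 ∈ Metric.ball p.2.2.2 r := by
    simp only [Metric.mem_ball, Prod.dist_eq, sup_lt_iff] at hq ⊢
    exact hq.2.2.2
  have hr : 0 < r := lt_of_le_of_lt dist_nonneg hqv
  have h := (convex_ball p.2.2.2 r).is_const_of_fderivWithin_eq_zero
    (f := fun s => a.rep (lift s (proj q))) (𝕜 := ℝ)
    (fun s hs => (hd s hs).differentiableAt.differentiableWithinAt) (fun s hs => by
      rw [fderivWithin_of_isOpen Metric.isOpen_ball hs]
      ext
      simp [(hd s hs).deriv]) hqv (Metric.mem_ball_self hr)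
  have e1 := a.rep_apply ⟨_, hmem _ hqv⟩
  have e2 := a.rep_apply ⟨_, hmem _ (Metric.mem_ball_self hr)⟩
  rw [hG] at e1 e2
  exact e1.symm.trans (h.trans e2)

theorem det_ne_zero_of_injective {E : Type*} [NormedAddCommGroup E] [NormedSpace ℝ E]
    [FiniteDimensional ℝ E] {L : E →L[ℝ] E} (h : ∀ e, L e = 0 → e = 0) : L.det ≠ 0 := by
  intro h0
  have hker : LinearMap.ker (L : E →ₗ[ℝ] E) = ⊥ := LinearMap.ker_eq_bot'.2 h
  exact (LinearMap.bot_lt_ker_of_det_eq_zero h0).ne' hker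

namespace IsPotentialAdmissible

variable {F F' : Coeff} {lam lam' : ℝ → ℝ} {Ω : Set E4} {φ : E4 → E4}

/-- A potential admissible transformation does not mix the potential into the other variables. -/
theorem proj_eq_slice (h : IsPotentialAdmissible F lam F' lam' Ω φ)
    (hF : F.MemL2) (hl : F.IsCharacteristic lam) (hl' : F'.IsCharacteristic lam')
    {p : E4} {r : ℝ} (hball : Metric.ball p r ⊆ Ω) {q : E4} (hq : q ∈ Metric.ball p r) :
    proj (φ q) = slice φ p.2.2.2 (proj q) := by
  have C := h.classified hF hl hl'
  exact Prod.ext (Sm.eq_on_slice C.Tv (G := potT φ) (fun _ => rfl) hball hq)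
    (Prod.ext (Sm.eq_on_slice C.Xv (G := potX φ) (fun _ => rfl) hball hq)
      (Sm.eq_on_slice C.Uv (G := potU φ) (fun _ => rfl) hball hq))

/-- The `(t,x,u)`-components of a potential admissible transformation form an admissible
transformation. -/
theorem isAdmissible_slice (h : IsPotentialAdmissible F lam F' lam' Ω φ)
    (hF : F.MemL2) (hl : F.IsCharacteristic lam) (hl' : F'.IsCharacteristic lam')
    {p : E4} {r : ℝ} (hball : Metric.ball p r ⊆ Ω) :
    IsAdmissible F F' (proj '' Metric.ball p r) (slice φ p.2.2.2) := by
  have C := h.classified hF hl hl'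
  have S := (F.source h.mem_source hl).1
  set D := Sm.partials h.opens with hD
  set c := p.2.2.2
  set ψ := slice φ c with hψ
  have hmem : ∀ y ∈ proj '' Metric.ball p r, lift c y ∈ h.opens := fun y hy => by
    rw [proj_image_ball] at hy
    exact hball hy
  have Tux : D.x (D.t h.T) = 0 ∧ D.u (D.t h.T) = 0 := by
    rw [D.xt, D.ut, C.Tx, C.Tu, map_zero]; exact ⟨rfl, rfl⟩
  have Ux := congrArg D.x C.Udef
  have Uu := congrArg D.u C.Udef
  have Ut := congrArg D.t C.Udef
  simp only [map_add, Derivation.leibniz, smul_eq_mul, D.xt, D.ut, D.ux, C.Tx, C.Tu, C.Xu, C.Xxx,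
    S.yx, S.yu, S.yt, map_zero, mul_zero, add_zero, zero_add, mul_one] at Ux Uu Ut
  obtain ⟨n, hn⟩ := C.unit_T.exists_right_inv
  obtain ⟨k, hk⟩ := C.unit_X.exists_right_inv
  have fd : ∀ (a : Sm h.opens) (G : E4 → ℝ), (∀ q : h.opens, a.val q = G q) → ∀ y,
      (hy : lift c y ∈ h.opens) → ∀ e, fderiv ℝ (fun y => G (lift c y)) y e =
        e.1 * (D.t a).val ⟨_, hy⟩ + e.2.1 * (D.x a).val ⟨_, hy⟩ +
          e.2.2 * (D.u a).val ⟨_, hy⟩ := by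
    intro a G hG y hy e
    rw [Sm.fderiv_lift a hG hy]
    simp [pair, Sm.cov, hD]
  have fT := fd h.T (potT φ) (fun _ => rfl)
  have fX := fd h.X (potX φ) (fun _ => rfl)
  have fU := fd h.U (potU φ) (fun _ => rfl)
  have hdT : ∀ (z : Jet1) (hz : lift c z.1 ∈ h.opens),
      Dt (compT ψ) z = (D.t h.T).val ⟨_, hz⟩ ∧ Dx (compT ψ) z = 0 := by
    intro z hz
    exact ⟨(fT z.1 hz _).trans (by simp [C.Tx, C.Tu]), (fT z.1 hz _).trans (by simp [C.Tx, C.Tu])⟩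
  have hdX : ∀ (z : Jet1) (hz : lift c z.1 ∈ h.opens),
      Dt (compX ψ) z = (D.t h.X).val ⟨_, hz⟩ ∧ Dx (compX ψ) z = (D.x h.X).val ⟨_, hz⟩ := by
    intro z hz
    exact ⟨(fX z.1 hz _).trans (by simp [C.Xu]), (fX z.1 hz _).trans (by simp [C.Xu])⟩
  have hdU : ∀ (z : Jet1) (hz : lift c z.1 ∈ h.opens),
      Dt (compU ψ) z = (D.t h.U).val ⟨_, hz⟩ + z.2.1 * (D.u h.U).val ⟨_, hz⟩ ∧
      Dx (compU ψ) z = (D.x h.U).val ⟨_, hz⟩ + z.2.2 * (D.u h.U).val ⟨_, hz⟩ := by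
    intro z hz
    exact ⟨(fU z.1 hz _).trans (by simp), (fU z.1 hz _).trans (by simp)⟩
  have vn : ∀ q, (D.t h.T).val q * n.val q = 1 := fun q =>
    congrArg (fun a : Sm h.opens => a.val q) hn
  have vk : ∀ q, (D.x h.X).val q * k.val q = 1 := fun q =>
    congrArg (fun a : Sm h.opens => a.val q) hk
  have vUx : ∀ q, (D.t h.T).val q * (D.x h.U).val q = (D.t (D.x h.X)).val q := fun q =>
    congrArg (fun a : Sm h.opens => a.val q) Ux
  have vUu : ∀ q, (D.t h.T).val q * (D.u h.U).val q = (D.x h.X).val q := fun q =>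
    congrArg (fun a : Sm h.opens => a.val q) Uu
  have hTt : ∀ q, (D.t h.T).val q ≠ 0 := fun q => left_ne_zero_of_mul (vn q ▸ one_ne_zero)
  have hXx : ∀ q, (D.x h.X).val q ≠ 0 := fun q => left_ne_zero_of_mul (vk q ▸ one_ne_zero)
  have hUu : ∀ q, (D.u h.U).val q ≠ 0 := fun q => right_ne_zero_of_mul (vUu q ▸ hXx q)
  have hsmooth := contDiffOn_slice h.point.smooth hball
  have hopen := isOpen_proj_image_ball p r
  refine ⟨⟨hopen, hsmooth, ?_⟩, ?_, ?_, ?_⟩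
  · intro y hy
    have hq := hmem y hy
    have hd : DifferentiableAt ℝ ψ y :=
      (hsmooth.contDiffAt (hopen.mem_nhds hy)).differentiableAt (by simp)
    refine det_ne_zero_of_injective fun e he => ?_
    have e1 := (hd.hasFDerivAt.fst).fderiv
    have e2 := (hd.hasFDerivAt.snd.fst).fderiv
    have e3 := (hd.hasFDerivAt.snd.snd).fderiv
    have e1' := (fT y hq e).symm.trans (congrArg (fun L => L e) e1)
    have e2' := (fX y hq e).symm.trans (congrArg (fun L => L e) e2)
    have e3' := (fU y hq e).symm.trans (congrArg (fun L => L e) e3)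
    simp only [ContinuousLinearMap.comp_apply, he, map_zero, C.Tx, C.Tu, C.Xu, Sm.val_zero,
      mul_zero, add_zero] at e1' e2' e3'
    have z1 : e.1 = 0 := (mul_eq_zero.1 e1').resolve_right (hTt _)
    rw [z1, zero_mul, zero_add] at e2' e3'
    have z2 : e.2.1 = 0 := (mul_eq_zero.1 e2').resolve_right (hXx _)
    rw [z2, zero_mul, zero_add] at e3'
    have z3 : e.2.2 = 0 := (mul_eq_zero.1 e3').resolve_right (hUu _)
    exact Prod.ext z1 (Prod.ext z2 z3)
  · intro y hy
    exact h.source _ (hmem y hy)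
  · intro y hy
    exact h.target _ (hmem y hy)
  intro w hw hJ
  have hq := hmem _ hw
  -- `u'_x'` is an affine function of `u_x` whose coefficients depend on `t` only
  have hnx : D.x n = 0 ∧ D.u n = 0 := by
    constructor
    · have := congrArg D.x hn
      simp only [Derivation.leibniz, smul_eq_mul, Tux.1, Derivation.map_one_eq_zero] at this
      exact C.unit_T.mul_left_cancel (by linear_combination this)
    · have := congrArg D.u hn
      simp only [Derivation.leibniz, smul_eq_mul, Tux.2, Derivation.map_one_eq_zero] at this
      exact C.unit_T.mul_left_cancel (by linear_combination this)
  have hkx : D.x k = 0 ∧ D.u k = 0 := by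
    constructor
    · have := congrArg D.x hk
      simp only [Derivation.leibniz, smul_eq_mul, C.Xxx, Derivation.map_one_eq_zero] at this
      exact C.unit_X.mul_left_cancel (by linear_combination this)
    · have := congrArg D.u hk
      simp only [Derivation.leibniz, smul_eq_mul, D.ux, C.Xu, map_zero,
        Derivation.map_one_eq_zero] at this
      exact C.unit_X.mul_left_cancel (by linear_combination this)
  set B : Sm h.opens := D.t (D.x h.X) * k * n with hB
  have hBx : D.x B = 0 ∧ D.u B = 0 := by
    constructor
    · simp [hB, Derivation.leibniz, D.xt, C.Xxx, hkx.1, hnx.1]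
    · simp [hB, Derivation.leibniz, D.ut, D.ux, C.Xu, hkx.2, hnx.2]
  have hUx : newUx ψ =ᶠ[nhds w.1] fun z => B.rep (lift c z.1) + z.2.2 * n.rep (lift c z.1) := by
    have hev : ∀ᶠ z : Jet1 in nhds w.1, z.1 ∈ proj '' Metric.ball p r :=
      continuous_fst.continuousAt.eventually (hopen.mem_nhds hw)
    filter_upwards [hev] with z hz
    have hzq := hmem _ hz
    rw [Sm.rep_apply _ ⟨_, hzq⟩, Sm.rep_apply _ ⟨_, hzq⟩, newUx, totalJac, (hdT z hzq).1,
      (hdT z hzq).2, (hdX z hzq).2, (hdU z hzq).2, zero_mul, zero_mul, sub_zero, sub_zero]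
    rw [div_eq_iff (mul_ne_zero (hTt _) (hXx _)), hB, Sm.val_mul, Sm.val_mul]
    have e1 := vn ⟨_, hzq⟩
    have e2 := vk ⟨_, hzq⟩
    have e3 := vUx ⟨_, hzq⟩
    have e4 := vUu ⟨_, hzq⟩
    linear_combination e3 + z.2.2 * e4
      - (D.t (D.x h.X)).val ⟨_, hzq⟩ * ((D.t h.T).val ⟨_, hzq⟩ * n.val ⟨_, hzq⟩ * e2 + e1)
      - z.2.2 * (D.x h.X).val ⟨_, hzq⟩ * e1
  have hDx1 : Dx₁ (newUx ψ) w = w.2.2.2 * n.val ⟨_, hq⟩ := by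
    have d1 : HasFDerivAt (fun z : Jet1 => B.rep (lift c z.1)) _ w.1 :=
      (B.differentiableAt_lift hq).hasFDerivAt.comp w.1 hasFDerivAt_fst
    have d2 : HasFDerivAt (fun z : Jet1 => n.rep (lift c z.1)) _ w.1 :=
      (n.differentiableAt_lift hq).hasFDerivAt.comp w.1 hasFDerivAt_fst
    have d3 : HasFDerivAt (fun z : Jet1 => z.2.2) ((ContinuousLinearMap.snd ℝ ℝ ℝ).comp
      (ContinuousLinearMap.snd ℝ E3 (ℝ × ℝ))) w.1 :=
      ((ContinuousLinearMap.snd ℝ ℝ ℝ).comp (ContinuousLinearMap.snd ℝ E3 (ℝ × ℝ))).hasFDerivAt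
    rw [Dx₁, hUx.fderiv_eq]
    rw [(d1.fun_add (d3.fun_mul d2)).fderiv]
    have fB := fd B B.rep (fun q => (B.rep_apply q).symm) _ hq (0, 1, w.1.2.2)
    have fn := fd n n.rep (fun q => (n.rep_apply q).symm) _ hq (0, 1, w.1.2.2)
    simp only [hBx, hnx, Sm.val_zero, zero_mul, mul_zero, add_zero] at fB fn
    simp [fB, fn, Sm.rep_apply n ⟨_, hq⟩, mul_comm]
  obtain ⟨q, hqdef⟩ : ∃ q : h.opens, q = ⟨_, hq⟩ := ⟨_, rfl⟩
  have vf : (F.at₀ h.mem_source).val q = F.f (w.1.1.1, w.1.1.2.1) := by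
    rw [Coeff.at₀, Sm.val_comp₂, hqdef]; rfl
  have vg : (F'.at₀ h.mem_target).val q = F'.f ((ψ w.1.1).1, (ψ w.1.1).2.1) := by
    rw [Coeff.at₀, Sm.val_comp₂, hqdef]; rfl
  have vU : h.U.val q = (ψ w.1.1).2.2 := by rw [hqdef]; rfl
  have vy : (Sm.cu h.opens).val q = w.1.1.2.2 := by rw [hqdef]; rfl
  have c1 := congrArg (fun a : Sm h.opens => a.val q) C.Udef
  have c2 := congrArg (fun a : Sm h.opens => a.val q) C.coeff
  have c3 := congrArg (fun a : Sm h.opens => a.val q) C.Ttt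
  have c4 := congrArg (fun a : Sm h.opens => a.val q) C.Xtt
  have c5 := congrArg (fun a : Sm h.opens => a.val q) Ut
  simp only [Sm.val_add, Sm.val_mul, Sm.val_pow, Sm.val_two] at c1 c2 c3 c4 c5
  change _ ↔ newUt ψ w.1 + (ψ w.1.1).2.2 * newUx ψ w.1 +
    F'.f ((ψ w.1.1).1, (ψ w.1.1).2.1) * newDx ψ (newUx ψ) w = 0
  rw [newUt, newUx, newDx, totalJac, hDx1, (hdT w.1 hq).1, (hdT w.1 hq).2, (hdX w.1 hq).1,
    (hdX w.1 hq).2, (hdU w.1 hq).1, (hdU w.1 hq).2, ← vg, ← vU, Coeff.BurgersEq, ← vf, ← vy,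
    ← hqdef]
  have hT0 := hTt q
  have hX0 := hXx q
  have vn := vn q
  have vUx := vUx q
  have vUu := vUu q
  generalize (D.t h.T).val q = Tt at *
  generalize (D.x h.X).val q = Xx at *
  rw [zero_mul, zero_mul, zero_mul, sub_zero, sub_zero, sub_zero, ← mul_div_assoc, ← mul_div_assoc,
    ← add_div, ← add_div, div_eq_zero_iff, or_iff_left (mul_ne_zero hT0 hX0)]
  -- the residual of the target equation is `X_x / T_t²` times that of the source equation
  refine Iff.trans (mul_eq_zero_iff_left (pow_ne_zero 2 hX0)).symm
    (Iff.trans ?_ (mul_eq_zero_iff_left hT0))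
  refine Eq.congr ?_ rfl
  linear_combination -(Xx * c5 + Xx * w.1.2.1 * vUu +
    ((D.x h.U).val q + w.1.2.2 * (D.u h.U).val q) * Tt * c1 +
    (Sm.cu h.opens).val q * Xx * (vUx + w.1.2.2 * vUu) +
    Tt * (F'.at₀ h.mem_target).val q * w.2.2.2 * vn - w.2.2.2 * c2 - h.U.val q * c3 -
    2 * (D.t (D.x h.X)).val q * c1 + c4)

end IsPotentialAdmissible

/-! ### Potential symmetries -/

theorem hasDerivAt_proj {γ : ℝ → E4} {γ' : E4} {s : ℝ} (h : HasDerivAt γ γ' s) :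
    HasDerivAt (fun r => proj (γ r)) (proj γ') s := by
  have h1 := h.fst
  have h2 := h.snd
  exact h1.prodMk (h2.fst.prodMk h2.snd.fst)

theorem exists_isLieSymmetryField {F : Coeff} {lam : ℝ → ℝ} (hF : F.MemL2)
    (hl : F.IsCharacteristic lam) {Ω : Set E4} {Q : E4 → E4}
    (hQ : IsLieSymmetryField (IsPotentialAdmissible F lam F lam) Ω Q) {p : E4} (hp : p ∈ Ω) :
    ∃ N : Set E4, IsOpen N ∧ p ∈ N ∧ N ⊆ Ω ∧ ∃ Q' : E3 → E3,
      IsLieSymmetryField (IsAdmissible F F) (proj '' N) Q' ∧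
      ∀ q ∈ N, proj (Q q) = Q' (proj q) := by
  obtain ⟨N, hN, hpN, hNΩ, ε, hε, Φ, hΦ, hΦ0, hflow, hsym⟩ := hQ.flow p hp
  obtain ⟨r, hr, hball⟩ := Metric.isOpen_iff.1 hN p hpN
  have h0 : (0 : ℝ) ∈ Set.Ioo (-ε) ε := ⟨by linarith, hε⟩
  have hproj : ∀ q ∈ Metric.ball p r, proj (Q q) = slice Q p.2.2.2 (proj q) := by
    intro q hq
    have hq' := lift_proj_mem_ball hq
    have d1 := hasDerivAt_proj (hflow 0 h0 q (hball hq)).2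
    have d2 := hasDerivAt_proj (hflow 0 h0 _ (hball hq')).2
    rw [hΦ0 _ (hball hq)] at d1
    rw [hΦ0 _ (hball hq')] at d2
    refine d1.unique (d2.congr_of_eventuallyEq ?_)
    filter_upwards [isOpen_Ioo.mem_nhds h0] with s hs
    exact (hsym s hs).proj_eq_slice hF hl hl hball hq
  refine ⟨Metric.ball p r, Metric.isOpen_ball, Metric.mem_ball_self hr, hball.trans hNΩ,
    slice Q p.2.2.2, ⟨isOpen_proj_image_ball p r,
      contDiffOn_slice hQ.smooth (hball.trans hNΩ), ?_⟩, hproj⟩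
  intro y hy
  have hq₀ : lift p.2.2.2 y ∈ Metric.ball p r := by rwa [proj_image_ball] at hy
  -- on a smaller ball and for short times the flow stays in `ball p r`
  have hcont : ContinuousAt (fun y : ℝ × E4 => Φ y.1 y.2) (0, lift p.2.2.2 y) :=
    (hΦ.contDiffAt ((isOpen_Ioo.prod hN).mem_nhds ⟨h0, hball hq₀⟩)).continuousAt
  have hev : ∀ᶠ z in nhds ((0 : ℝ), lift p.2.2.2 y),
      z.2 ∈ Metric.ball p r ∧ Φ z.1 z.2 ∈ Metric.ball p r :=
    (continuous_snd.continuousAt.eventually (Metric.isOpen_ball.mem_nhds hq₀)).and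
      (hcont.eventually (Metric.isOpen_ball.mem_nhds
        (by show Φ 0 (lift p.2.2.2 y) ∈ _; rwa [hΦ0 _ (hball hq₀)])))
  obtain ⟨δ, hδ, hδball⟩ := Metric.eventually_nhds_iff_ball.1 hev
  have hsmall : ∀ s ∈ Set.Ioo (-min ε δ) (min ε δ), s ∈ Set.Ioo (-ε) ε ∧
      ∀ q ∈ Metric.ball (lift p.2.2.2 y) δ, q ∈ Metric.ball p r ∧ Φ s q ∈ Metric.ball p r := by
    intro s hs
    have hs' := abs_lt.2 hs
    refine ⟨abs_lt.1 (hs'.trans_le (min_le_left _ _)), fun q hq => hδball (s, q) ?_⟩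
    rw [← ball_prod_same]
    refine ⟨?_, hq⟩
    simpa using hs'.trans_le (min_le_right _ _)
  have hδ0 : Metric.ball (lift p.2.2.2 y) δ ⊆ Metric.ball p r := fun q hq =>
    ((hsmall 0 ⟨by simp [hε, hδ], by simp [hε, hδ]⟩).2 q hq).1
  have hmem : ∀ y' ∈ proj '' Metric.ball (lift p.2.2.2 y) δ,
      lift p.2.2.2 y' ∈ Metric.ball (lift p.2.2.2 y) δ := by
    intro y' hy'
    rwa [proj_image_ball] at hy'
  refine ⟨proj '' Metric.ball (lift p.2.2.2 y) δ, isOpen_proj_image_ball _ _,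
    ⟨_, Metric.mem_ball_self hδ, rfl⟩, Set.image_mono hδ0, min ε δ, lt_min hε hδ,
    fun s => slice (Φ s) p.2.2.2, ?_, ?_, ?_, ?_⟩
  · refine contDiff_proj.comp_contDiffOn (hΦ.comp (t := Set.Ioo (-ε) ε ×ˢ N)
      (f := fun z : ℝ × E3 => (z.1, lift p.2.2.2 z.2))
      (contDiff_fst.prodMk ((contDiff_lift _).comp contDiff_snd)).contDiffOn ?_)
    rintro ⟨s, y'⟩ ⟨hs, hy'⟩
    exact ⟨(hsmall s hs).1, hball (hδ0 (hmem y' hy'))⟩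
  · intro y' hy'
    simp only [slice]
    rw [hΦ0 _ (hball (hδ0 (hmem y' hy')))]
    rfl
  · intro s hs y' hy'
    obtain ⟨hsε, hs'⟩ := hsmall s hs
    have hin := (hs' _ (hmem y' hy')).2
    refine ⟨⟨_, hin, rfl⟩, ?_⟩
    have := hasDerivAt_proj (hflow s hsε _ (hball (hδ0 (hmem y' hy')))).2
    rwa [hproj _ hin] at this
  · intro s hs
    exact (hsym s (hsmall s hs).1).isAdmissible_slice hF hl hl (p := lift p.2.2.2 y)
      (hδ0.trans hball)

end GenBurgers

end

theorem proposition3 :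
    -- potential admissible transformations are induced by usual admissible transformations
    (∀ (F F' : GenBurgers.Coeff) (lam lam' : ℝ → ℝ),
      F.MemL2 → F'.MemL2 → F.IsCharacteristic lam → F'.IsCharacteristic lam' →
      ∀ (Ω : Set GenBurgers.E4) (φ : GenBurgers.E4 → GenBurgers.E4),
        GenBurgers.IsPotentialAdmissible F lam F' lam' Ω φ →
        ∀ p ∈ Ω, ∃ N : Set GenBurgers.E4, IsOpen N ∧ p ∈ N ∧ N ⊆ Ω ∧
          ∃ ψ : GenBurgers.E3 → GenBurgers.E3,
            GenBurgers.IsAdmissible F F' (GenBurgers.proj '' N) ψ ∧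
            ∀ q ∈ N, GenBurgers.proj (φ q) = ψ (GenBurgers.proj q)) ∧
    -- there are no nontrivial potential symmetries
    (∀ (F : GenBurgers.Coeff) (lam : ℝ → ℝ), F.MemL2 → F.IsCharacteristic lam →
      ∀ (Ω : Set GenBurgers.E4) (Q : GenBurgers.E4 → GenBurgers.E4),
        GenBurgers.IsLieSymmetryField (GenBurgers.IsPotentialAdmissible F lam F lam) Ω Q →
        ∀ p ∈ Ω, ∃ N : Set GenBurgers.E4, IsOpen N ∧ p ∈ N ∧ N ⊆ Ω ∧
          ∃ Q' : GenBurgers.E3 → GenBurgers.E3,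
            GenBurgers.IsLieSymmetryField (GenBurgers.IsAdmissible F F)
              (GenBurgers.proj '' N) Q' ∧
            ∀ q ∈ N, GenBurgers.proj (Q q) = Q' (GenBurgers.proj q)) := by
  refine ⟨?_, ?_⟩
  · intro F F' lam lam' hF _ hl hl' Ω φ h p hp
    obtain ⟨r, hr, hball⟩ := Metric.isOpen_iff.1 h.point.isOpen p hp
    exact ⟨Metric.ball p r, Metric.isOpen_ball, Metric.mem_ball_self hr, hball, _,
      h.isAdmissible_slice hF hl hl' hball, fun q hq => h.proj_eq_slice hF hl hl' hball hq⟩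
  · intro F lam hF hl Ω Q hQ p hp
    exact GenBurgers.exists_isLieSymmetryField hF hl hQ hp
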